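/- **Setting.** Let $\mathcal X$ be a measurable space with base measure $\mathrm dx$, and for $t\in[0,1]$ let $W_t:\mathcal X\to\mathbb R$ be measurable with $0<Z_t=\int_{\mathcal X}e^{W_t(x)}\,\mathrm dx<\infty$. Put $\pi_t(x)=Z_t^{-1}e^{W_t(x)}$ and assume that $t\mapsto\pi_t(x)$ is continuous on $[0,1]$ for every $x$ (an annealing path). For $t,t'\in[0,1]$ let $$A_{t,t'}(x,x')=(W_{t'}(x)-W_t(x))-(W_{t'}(x')-W_t(x')),$$ $$r(t,t')=1-\mathbb E\big[\exp(\min\{0,A_{t,t'}(X,X')\})\big],\qquad X\sim\pi_t,\ X'\sim\pi_{t'}\ \text{independent},$$ $$\Lambda(t,t')=\frac12\int_0^1\mathbb E\big[|A_{t,t'}(X_s,X_s')|\big]\,\mathrm ds,\qquad X_s,X_s'\ \text{i.i.d. with density}\propto\exp((1-s)W_t+sW_{t'}).$$ For a schedule $\mathcal T_N=(t_n)_{n=0}^N$, $0=t_0\le t_1\le\dots\le t_N=1$, let $\|\mathcal T_N\|=\max_{0\le n<N}(t_{n+1}-t_n)$, $\Lambda(\mathcal T_N)=\sum_{n=0}^{N-1}\Lambda(t_n,t_{n+1})$,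 and let the round trip rate be $$\tau(\mathcal T_N)=\Big(2+2\sum_{n=0}^{N-1}\frac{r(t_n,t_{n+1})}{1-r(t_n,t_{n+1})}\Big)^{-1}.$$ **Theorem.** Suppose that for every $x\in\mathcal X$ the map $t\mapsto W_t(x)$ is piecewise twice continuously differentiable on $[0,1]$ (that is, $C^2$ away from finitely many points, which may depend on $x$), and that there are measurable $V_1,V_2:\mathcal X\to[0,\infty)$ and $\varepsilon>0$ such that for all $x$ $$\sup_{t\in[0,1]}\Big|\frac{\mathrm dW_t}{\mathrm dt}(x)\Big|\le V_1(x),\qquad \sup_{t\in[0,1]}\Big|\frac{\mathrm d^2W_t}{\mathrm dt^2}(x)\Big|\le V_2(x)$$ (suprema over the $t$ at which the derivatives exist; derivatives at $t=0,1$ are one-sided), and $$\sup_{t\in[0,1]}\mathbb E_{\pi_t}[V_1^3]<\infty,\qquad \sup_{t\in[0,1]}\mathbb E_{\pi_t}\big[(1+V_1)\exp(\varepsilon V_2)\big]<\infty.$$ For almost every $t\in[0,1]$ the derivative $\frac{\mathrm dW_t}{\mathrm dt}(x)$ then exists for almost every $x\in\mathcal X$. At every $t\in[0,1]$ with this property let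 $$\lambda(t)=\frac12\,\mathbb E\Big[\Big|\frac{\mathrm dW_t}{\mathrm dt}(X_t)-\frac{\mathrm dW_t}{\mathrm dt}(X_t')\Big|\Big],\qquad X_t,X_t'\overset{\text{i.i.d.}}{\sim}\pi_t.$$ Then $\lambda(t)<\infty$ and $$\lambda(t)=\lim_{\Delta t\to0}\frac{r(t+\Delta t,t)}{|\Delta t|}\qquad(\Delta t\ne0,\ t+\Delta t\in[0,1])$$ at every such $t$, the function $\lambda$ is integrable on $[0,1]$, and, with $\Lambda=\int_0^1\lambda(t)\,\mathrm dt$, $$\lim_{\delta\to0^+}\ \sup_{\mathcal T_N:\,\|\mathcal T_N\|\le\delta}\big|(2+2\Lambda(\mathcal T_N))^{-1}-\tau(\mathcal T_N)\big|=0,\qquad \lim_{\delta\to0^+}\ \sup_{\mathcal T_N:\,\|\mathcal T_N\|\le\delta}\big|\Lambda(\mathcal T_N)-\Lambda\big|=0,$$ where the suprema are over all $N\ge1$ and all schedules $\mathcal T_N$ with $\|\mathcal T_N\|\le\delta$. -/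

import Mathlib

open MeasureTheory Set Filter Topology
open scoped ENNReal NNReal

noncomputable section

namespace Annealing

variable {X : Type*} [MeasurableSpace X]

/-- The density `π_t(x) = exp (W_t(x)) / Z_t` with respect to the base measure `ν`, where
`Z_t = ∫ exp (W_t) dν`. -/
def density (ν : Measure X) (W : ℝ → X → ℝ) (t : ℝ) (x : X) : ℝ :=
  Real.exp (W t x) / ∫ y, Real.exp (W t y) ∂ν

/-- The distribution `π_t`, i.e. the measure with density `density ν W t` with respect to `ν`
(this is how `Measure.tilted` is defined). -/
def law (ν : Measure X) (W : ℝ → X → ℝ) (t : ℝ) : Measure X :=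
  ν.tilted (W t)

/-- `sup_{t ∈ [0,1]} E_{π_t}[f]` as an element of `[0, ∞]`, for `f ≥ 0`. -/
def supMean (ν : Measure X) (W : ℝ → X → ℝ) (f : X → ℝ≥0∞) : ℝ≥0∞ :=
  ⨆ t ∈ Icc (0 : ℝ) 1, ∫⁻ x, f x ∂(law ν W t)

/-- The log-densities `W_t`, `t ∈ [0, 1]`, define an annealing path: each `exp (W_t)` is a
normalizable (automatically everywhere positive) density with respect to `ν`, and `π_t(x)` is
continuous in `t ∈ [0, 1]` for every `x`. Values of `W` outside `[0, 1]` play no role. -/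
structure IsAnnealingPath (ν : Measure X) (W : ℝ → X → ℝ) : Prop where
  measurable : ∀ t ∈ Icc (0 : ℝ) 1, Measurable (W t)
  integrable : ∀ t ∈ Icc (0 : ℝ) 1, Integrable (fun x => Real.exp (W t x)) ν
  normalizer_pos : ∀ t ∈ Icc (0 : ℝ) 1, 0 < ∫ x, Real.exp (W t x) ∂ν
  continuousOn : ∀ x, ContinuousOn (fun t => density ν W t x) (Icc (0 : ℝ) 1)

/-- `f` is piecewise twice continuously differentiable on `[0, 1]`: it is `C²` away from a finite
set of points. Nothing is required at these points, so jumps and kinks are allowed there. -/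
def PiecewiseC2 (f : ℝ → ℝ) : Prop :=
  ∃ K : Finset ℝ, ContDiffOn ℝ 2 f (Icc (0 : ℝ) 1 \ K)

/-- `dW_t/dt (x)`, one-sided at `t = 0` and `t = 1` (and `0` where the derivative does not exist). -/
def dW (W : ℝ → X → ℝ) (t : ℝ) (x : X) : ℝ :=
  derivWithin (fun u => W u x) (Icc (0 : ℝ) 1) t

/-- `d²W_t/dt² (x)`, one-sided at `t = 0` and `t = 1`. -/
def d2W (W : ℝ → X → ℝ) (t : ℝ) (x : X) : ℝ :=
  derivWithin (fun u => dW W u x) (Icc (0 : ℝ) 1) t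

/-- `A_{t,t'}(x, x') = (W_{t'}(x) - W_t(x)) - (W_{t'}(x') - W_t(x'))`. -/
def swapExponent (W : ℝ → X → ℝ) (t t' : ℝ) (x x' : X) : ℝ :=
  (W t' x - W t x) - (W t' x' - W t x')

/-- The rejection rate `r(t,t') = 1 - E[exp (min {0, A_{t,t'}(X, X')})]`, with independent
`X ∼ π_t`, `X' ∼ π_{t'}`. -/
def rejection (ν : Measure X) (W : ℝ → X → ℝ) (t t' : ℝ) : ℝ :=
  1 - ∫ p : X × X, Real.exp (min 0 (swapExponent W t t' p.1 p.2))
        ∂((law ν W t).prod (law ν W t'))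

/-- The point at parameter `s` of the linear (in log-density) path from `π_t` to `π_{t'}`: the
probability measure with density proportional to `exp ((1 - s) W_t + s W_{t'})`. -/
def secantLaw (ν : Measure X) (W : ℝ → X → ℝ) (t t' s : ℝ) : Measure X :=
  ν.tilted (fun x => (1 - s) * W t x + s * W t' x)

/-- `Λ(t,t') = (1/2) ∫₀¹ E|A_{t,t'}(X_s, X'_s)| ds`, with `X_s, X'_s` i.i.d. from
`secantLaw ν W t t' s`. -/
def secantBarrier (ν : Measure X) (W : ℝ → X → ℝ) (t t' : ℝ) : ℝ :=
  1 / 2 * ∫ s in (0 : ℝ)..1, ∫ p : X × X, |swapExponent W t t' p.1 p.2|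
        ∂((secantLaw ν W t t' s).prod (secantLaw ν W t t' s))

/-- An annealing schedule `0 = t_0 ≤ t_1 ≤ ⋯ ≤ t_N = 1`. -/
structure Schedule (N : ℕ) where
  pt : Fin (N + 1) → ℝ
  monotone : Monotone pt
  zero : pt 0 = 0
  last : pt (Fin.last N) = 1

/-- `‖T_N‖ = max_n (t_{n+1} - t_n)`. -/
def Schedule.mesh {N : ℕ} (T : Schedule N) : ℝ :=
  ⨆ n : Fin N, (T.pt n.succ - T.pt n.castSucc)

/-- The round trip rate
`τ(T_N) = (2 + 2 ∑_n r(t_n,t_{n+1}) / (1 - r(t_n,t_{n+1})))⁻¹`. -/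
def roundTripRate (ν : Measure X) (W : ℝ → X → ℝ) {N : ℕ} (T : Schedule N) : ℝ :=
  (2 + 2 * ∑ n : Fin N, rejection ν W (T.pt n.castSucc) (T.pt n.succ) /
      (1 - rejection ν W (T.pt n.castSucc) (T.pt n.succ)))⁻¹

/-- `Λ(T_N) = ∑_n Λ(t_n,t_{n+1})`. -/
def scheduleBarrier (ν : Measure X) (W : ℝ → X → ℝ) {N : ℕ} (T : Schedule N) : ℝ :=
  ∑ n : Fin N, secantBarrier ν W (T.pt n.castSucc) (T.pt n.succ)

/-- The instantaneous rejection rate `λ(t) = (1/2) E|dW_t/dt (X) - dW_t/dt (X')|`, with `X, X'`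
i.i.d. from `π_t`. -/
def instRejection (ν : Measure X) (W : ℝ → X → ℝ) (t : ℝ) : ℝ :=
  1 / 2 * ∫ p : X × X, |dW W t p.1 - dW W t p.2| ∂((law ν W t).prod (law ν W t))

/-- The global communication barrier `Λ = ∫₀¹ λ(t) dt`. -/
def globalBarrier (ν : Measure X) (W : ℝ → X → ℝ) : ℝ :=
  ∫ t in (0 : ℝ)..1, instRejection ν W t

end Annealing

end

/-! ### Tilted measures whose exponents have close increments -/

noncomputable section

namespace Annealing

variable {X : Type*} [MeasurableSpace X]

/-! Everything depends only on the increments `W t x - W t y`. These equal `log π_t(x) - log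
π_t(y)`, so they are continuous in `t` even where `W t x` jumps, and the derivative bound makes them
Lipschitz in `t` with constant `V x + V y`. Together with uniform first and second moments of `V`,
this is the notion of `LipschitzPath`, supplied by `exists_lipschitzPath`.

The basic estimate is `abs_density_sub_le`: densities at times `a` and `b` differ by `O(|b - a|)`,
with a weight linear in `V`. Hence means of functions growing linearly in `V` are Lipschitz in time.
The swap exponent is itself `O(|b - a|)`, so changing the sampling law costs only `O((b - a)²)`.
Consequently the rejection rate, its odds `r / (1 - r)` and the secant barrier all agree with the
single quantity `meanSwap ν W a a b` up to `C * (b - a)²`.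

When `a` and `b` close in on `t`, dominated convergence gives `meanSwap ν W t a b / (b - a) → λ(t)`
wherever almost every exponent is differentiable (`tendsto_meanSwap_div`); a Fubini argument shows
this is so for almost every `t`. A sum over a schedule is the integral of a bounded step function
converging almost everywhere to `λ`, so both the summed odds and the summed secant barriers tend to
`Λ`, uniformly as the mesh shrinks (`exists_mesh_abs_sum_sub_le`). The round trip rate follows
because `u ↦ (2 + 2u)⁻¹` is Lipschitz on `u ≥ 0`. -/

lemma abs_exp_sub_exp_le (a b : ℝ) :
    |Real.exp a - Real.exp b| ≤ |a - b| * (Real.exp a + Real.exp b) := by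
  wlog h : b ≤ a generalizing a b
  · rw [abs_sub_comm, abs_sub_comm a b, add_comm]
    exact this b a (le_of_not_ge h)
  rw [abs_of_nonneg (sub_nonneg.2 (Real.exp_le_exp.2 h)), abs_of_nonneg (sub_nonneg.2 h)]
  have h1 : Real.exp b = Real.exp a * Real.exp (b - a) := by
    rw [← Real.exp_add]; ring_nf
  have h2 := Real.add_one_le_exp (b - a)
  have h3 := Real.exp_pos a
  have h4 := Real.exp_pos b
  nlinarith [mul_le_mul_of_nonneg_left h2 h3.le, mul_nonneg (sub_nonneg.2 h) h4.le]

/-- The density of `ν.tilted f` with respect to `ν`. -/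
def tiltedDensity (ν : Measure X) (f : X → ℝ) (x : X) : ℝ :=
  Real.exp (f x) / ∫ y, Real.exp (f y) ∂ν

/-- `exp f` is integrable, and the first two moments of `V` under `ν.tilted f` are at most `M`. -/
structure MomentBound (ν : Measure X) (V : X → ℝ≥0) (M : ℝ) (f : X → ℝ) : Prop where
  measurable : Measurable f
  integrable_exp : Integrable (fun x => Real.exp (f x)) ν
  integrable_sq : Integrable (fun x => (V x : ℝ) ^ 2) (ν.tilted f)
  integral_le : ∫ x, (V x : ℝ) ∂(ν.tilted f) ≤ M
  integral_sq_le : ∫ x, (V x : ℝ) ^ 2 ∂(ν.tilted f) ≤ M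

/-- The increments of `g - f` are controlled by `h * V`. -/
def IncrementBound (V : X → ℝ≥0) (h : ℝ) (f g : X → ℝ) : Prop :=
  ∀ x y, |(g x - f x) - (g y - f y)| ≤ h * (V x + V y)

variable {ν : Measure X} {V : X → ℝ≥0} {M h k c : ℝ} {f g r : X → ℝ}

lemma integral_tilted_eq (φ : X → ℝ) :
    ∫ x, φ x ∂(ν.tilted f) = ∫ x, tiltedDensity ν f x * φ x ∂ν := by
  rw [integral_tilted]; rfl

namespace MomentBound

lemma integrable_density (hf : MomentBound ν V M f) : Integrable (tiltedDensity ν f) ν :=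
  hf.integrable_exp.div_const _

lemma integral_density_mul_le (hf : MomentBound ν V M f) :
    ∫ x, tiltedDensity ν f x * V x ∂ν ≤ M := by
  rw [← integral_tilted_eq]; exact hf.integral_le

end MomentBound

variable [NeZero ν]

lemma tiltedDensity_pos (hf : Integrable (fun x => Real.exp (f x)) ν) (x : X) :
    0 < tiltedDensity ν f x := div_pos (Real.exp_pos _) (integral_exp_pos hf)

lemma integrable_tilted_iff_mul (hf : Integrable (fun x => Real.exp (f x)) ν) (φ : X → ℝ) :
    Integrable φ (ν.tilted f) ↔ Integrable (fun x => tiltedDensity ν f x * φ x) ν := by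
  rw [integrable_tilted_iff hf]
  have : (fun x => tiltedDensity ν f x * φ x)
      = fun x => (∫ y, Real.exp (f y) ∂ν)⁻¹ * (Real.exp (f x) • φ x) := by
    funext x; simp only [tiltedDensity, smul_eq_mul]; ring
  rw [this, integrable_const_mul_iff (isUnit_iff_ne_zero.2 (inv_ne_zero (integral_exp_pos hf).ne'))]

namespace MomentBound

lemma isProbabilityMeasure (hf : MomentBound ν V M f) : IsProbabilityMeasure (ν.tilted f) :=
  isProbabilityMeasure_tilted hf.integrable_exp

lemma integrable (hf : MomentBound ν V M f) (hV : Measurable V) :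
    Integrable (fun x => (V x : ℝ)) (ν.tilted f) := by
  have := hf.isProbabilityMeasure
  refine ((integrable_const (1 : ℝ)).add hf.integrable_sq).mono'
    (by fun_prop) (Eventually.of_forall fun x => ?_)
  rw [Real.norm_of_nonneg (NNReal.coe_nonneg _)]
  simp only [Pi.add_apply]
  nlinarith [sq_nonneg ((V x : ℝ) - 1), (V x).2]

lemma integral_density (hf : MomentBound ν V M f) : ∫ x, tiltedDensity ν f x ∂ν = 1 := by
  have := hf.isProbabilityMeasure
  have h := integral_tilted_eq (ν := ν) (f := f) (fun _ => 1)
  simpa using h.symm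

lemma integrable_density_mul (hf : MomentBound ν V M f) (hV : Measurable V) :
    Integrable (fun x => tiltedDensity ν f x * V x) ν :=
  (integrable_tilted_iff_mul hf.integrable_exp _).1 (hf.integrable hV)

/-- Two tilted measures whose exponents differ little have close densities. -/
lemma abs_density_sub_le (hV : Measurable V) (hf : MomentBound ν V M f) (hg : MomentBound ν V M g)
    (hh : 0 ≤ h) (hfg : IncrementBound V h f g) (x : X) :
    |tiltedDensity ν f x - tiltedDensity ν g x|
      ≤ h * ((V x + M) * (tiltedDensity ν f x + tiltedDensity ν g x)) := by
  set p := tiltedDensity ν f with hp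
  set q := tiltedDensity ν g with hq
  have hp0 := tiltedDensity_pos hf.integrable_exp
  have hq0 := tiltedDensity_pos hg.integrable_exp
  -- Since `p` and `q` have mass one, the difference becomes an average over `y`. Both products then
  -- carry the same normalizer `Z_f Z_g`, so only increments of `g - f` between `x` and `y` remain
  -- and no estimate on the normalizers is needed.
  have e1 : p x - q x = ∫ y, (p x * q y - q x * p y) ∂ν := by
    rw [integral_sub (hg.integrable_density.const_mul _) (hf.integrable_density.const_mul _),
      integral_const_mul, integral_const_mul, hf.integral_density, hg.integral_density]
    ring
  have hi1 := hg.integrable_density.const_mul (V x : ℝ)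
  have hi2 := hf.integrable_density.const_mul (V x : ℝ)
  have hj1 : Integrable (fun y => p x * (V x * q y + q y * V y)) ν :=
    (hi1.add (hg.integrable_density_mul hV)).const_mul (p x)
  have hj2 : Integrable (fun y => q x * (V x * p y + p y * V y)) ν :=
    (hi2.add (hf.integrable_density_mul hV)).const_mul (q x)
  have key : |p x - q x| ≤ ∫ y, h * (p x * (V x * q y + q y * V y)
      + q x * (V x * p y + p y * V y)) ∂ν := by
    rw [e1, ← Real.norm_eq_abs]
    refine norm_integral_le_of_norm_le ((hj1.add hj2).const_mul h) (Eventually.of_forall fun y => ?_)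
    have hZ : 0 < (∫ y, Real.exp (f y) ∂ν) * ∫ y, Real.exp (g y) ∂ν :=
      mul_pos (integral_exp_pos hf.integrable_exp) (integral_exp_pos hg.integrable_exp)
    have a1 : p x * q y = Real.exp (f x + g y) /
        ((∫ y, Real.exp (f y) ∂ν) * ∫ y, Real.exp (g y) ∂ν) := by
      simp only [hp, hq, tiltedDensity, Real.exp_add]; ring
    have a2 : q x * p y = Real.exp (g x + f y) /
        ((∫ y, Real.exp (f y) ∂ν) * ∫ y, Real.exp (g y) ∂ν) := by
      simp only [hp, hq, tiltedDensity, Real.exp_add]; ring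
    have a3 : |p x * q y - q x * p y| ≤ h * (V x + V y) * (p x * q y + q x * p y) := by
      rw [a1, a2, ← sub_div, ← add_div, abs_div, abs_of_pos hZ, ← mul_div_assoc]
      refine div_le_div_of_nonneg_right ((abs_exp_sub_exp_le _ _).trans ?_) hZ.le
      refine mul_le_mul_of_nonneg_right ?_ (by positivity)
      have := hfg x y
      rw [abs_sub_comm] at this
      rwa [show f x + g y - (g x + f y) = g y - f y - (g x - f x) by ring]
    rw [Real.norm_eq_abs]
    refine a3.trans (le_of_eq ?_)
    ring
  refine key.trans ?_
  rw [integral_const_mul]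
  refine mul_le_mul_of_nonneg_left ?_ hh
  have b1 : ∫ y, (p x * (V x * q y + q y * V y) + q x * (V x * p y + p y * V y)) ∂ν
      = p x * (V x + ∫ y, q y * V y ∂ν) + q x * (V x + ∫ y, p y * V y ∂ν) := by
    rw [integral_add hj1 hj2, integral_const_mul, integral_const_mul,
      integral_add hi1 (hg.integrable_density_mul hV),
      integral_add hi2 (hf.integrable_density_mul hV),
      integral_const_mul, integral_const_mul, hf.integral_density, hg.integral_density, mul_one]
  rw [b1]
  have b2 := hf.integral_density_mul_le
  have b3 := hg.integral_density_mul_le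
  have b4 := (hp0 x).le
  have b5 := (hq0 x).le
  nlinarith [mul_le_mul_of_nonneg_left b2 b5, mul_le_mul_of_nonneg_left b3 b4]

/-- Expectations of functions of linear growth in `V` are Lipschitz in the exponent. -/
lemma abs_integral_sub_le (hV : Measurable V) (hM : 1 ≤ M)
    (hf : MomentBound ν V M f) (hg : MomentBound ν V M g)
    (hh : 0 ≤ h) (hfg : IncrementBound V h f g) {φ : X → ℝ} (hφ : Measurable φ)
    (hc : 0 ≤ c) (hk : 0 ≤ k) (hφb : ∀ x, |φ x| ≤ k * (c + V x)) :
    |∫ x, φ x ∂(ν.tilted f) - ∫ x, φ x ∂(ν.tilted g)| ≤ 4 * h * k * M * (c + M) := by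
  have := hf.isProbabilityMeasure
  have := hg.isProbabilityMeasure
  have hφi : ∀ {u : X → ℝ}, MomentBound ν V M u → Integrable φ (ν.tilted u) := by
    intro u hu
    have := hu.isProbabilityMeasure
    exact (((integrable_const c).add (hu.integrable hV)).const_mul k).mono'
      hφ.aestronglyMeasurable (Eventually.of_forall hφb)
  -- The growth `c + V` of `φ` times the weight `V + M` of the density estimate is quadratic in `V`;
  -- this is where the second moment enters.
  have hqi : ∀ {u : X → ℝ}, MomentBound ν V M u →
      Integrable (fun x => (c + V x) * (V x + M)) (ν.tilted u) ∧
      ∫ x, ((c + V x) * (V x + M)) ∂(ν.tilted u) ≤ 2 * M * (c + M) := by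
    intro u hu
    have := hu.isProbabilityMeasure
    have e : (fun x => (c + V x) * (V x + M)) =
        fun x => c * M + ((c + M) * V x + (V x : ℝ) ^ 2) := by funext x; ring
    have i1 := (hu.integrable hV).const_mul (c + M)
    have i2 : Integrable (fun x => (c + M) * V x + (V x : ℝ) ^ 2) (ν.tilted u) :=
      i1.add hu.integrable_sq
    rw [e]
    refine ⟨(integrable_const _).add i2, ?_⟩
    rw [integral_add (integrable_const _) i2,
      integral_add i1 hu.integrable_sq, integral_const_mul (c + M)]
    simp only [integral_const, probReal_univ, smul_eq_mul, one_mul]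
    have := hu.integral_le
    have := hu.integral_sq_le
    nlinarith [mul_le_mul_of_nonneg_left hu.integral_le (by linarith : 0 ≤ c + M)]
  have if' := (integrable_tilted_iff_mul hf.integrable_exp _).1 (hφi hf)
  have ig' := (integrable_tilted_iff_mul hg.integrable_exp _).1 (hφi hg)
  have jf := (integrable_tilted_iff_mul hf.integrable_exp _).1 (hqi hf).1
  have jg := (integrable_tilted_iff_mul hg.integrable_exp _).1 (hqi hg).1
  rw [integral_tilted_eq, integral_tilted_eq, ← integral_sub if' ig', ← Real.norm_eq_abs]
  refine (norm_integral_le_of_norm_le ((jf.add jg).const_mul (h * k))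
    (Eventually.of_forall fun x => ?_)).trans ?_
  · have h1 := abs_density_sub_le hV hf hg hh hfg x
    rw [Real.norm_eq_abs, ← sub_mul, abs_mul]
    refine (mul_le_mul h1 (hφb x) (abs_nonneg _) ((abs_nonneg _).trans h1)).trans (le_of_eq ?_)
    simp only [Pi.add_apply]
    ring
  · rw [integral_const_mul]
    have h3 := (hqi hf).2
    have h4 := (hqi hg).2
    rw [integral_tilted_eq] at h3 h4
    simp only [Pi.add_apply]
    rw [integral_add jf jg]
    have : 0 ≤ h * k := by positivity
    nlinarith

lemma integrable_prod (hV : Measurable V) (hf : MomentBound ν V M f) (hg : MomentBound ν V M g)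
    {Φ : X × X → ℝ} (hΦ : Measurable Φ) (hΦb : ∀ p, |Φ p| ≤ k * (V p.1 + V p.2)) :
    Integrable Φ ((ν.tilted f).prod (ν.tilted g)) := by
  have := hf.isProbabilityMeasure
  have := hg.isProbabilityMeasure
  exact ((((hf.integrable hV).comp_fst _).add ((hg.integrable hV).comp_snd _)).const_mul k).mono'
    hΦ.aestronglyMeasurable (Eventually.of_forall hΦb)

lemma abs_integral_prod_le (hV : Measurable V) (hf : MomentBound ν V M f)
    (hg : MomentBound ν V M g) {Φ : X × X → ℝ} (hk : 0 ≤ k)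
    (hΦb : ∀ p, |Φ p| ≤ k * (V p.1 + V p.2)) :
    |∫ p, Φ p ∂((ν.tilted f).prod (ν.tilted g))| ≤ 2 * k * M := by
  have := hf.isProbabilityMeasure
  have := hg.isProbabilityMeasure
  have i1 : Integrable (fun p : X × X => (V p.1 : ℝ)) ((ν.tilted f).prod (ν.tilted g)) :=
    (hf.integrable hV).comp_fst _
  have i2 : Integrable (fun p : X × X => (V p.2 : ℝ)) ((ν.tilted f).prod (ν.tilted g)) :=
    (hg.integrable hV).comp_snd _
  rw [← Real.norm_eq_abs]
  refine (norm_integral_le_of_norm_le ((i1.add i2).const_mul k)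
    (Eventually.of_forall hΦb)).trans ?_
  rw [integral_const_mul]
  simp only [Pi.add_apply]
  rw [integral_add i1 i2, integral_fun_fst (fun x => (V x : ℝ)),
    integral_fun_snd (fun x => (V x : ℝ))]
  simp only [probReal_univ, one_smul]
  nlinarith [hf.integral_le, hg.integral_le]

/-- With the first coordinate frozen at `x`, the section of `Φ` has growth `k * (c + V)` with `c = V
x`. The one-variable bound is then linear in `V x` and integrates against `ν.tilted r`. -/
lemma abs_integral_prod_sub_right_le (hV : Measurable V) (hM : 1 ≤ M) (hr : MomentBound ν V M r)
    (hf : MomentBound ν V M f) (hg : MomentBound ν V M g)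
    (hh : 0 ≤ h) (hfg : IncrementBound V h f g) {Φ : X × X → ℝ} (hΦ : Measurable Φ)
    (hk : 0 ≤ k) (hΦb : ∀ p, |Φ p| ≤ k * (V p.1 + V p.2)) :
    |∫ p, Φ p ∂((ν.tilted r).prod (ν.tilted f)) - ∫ p, Φ p ∂((ν.tilted r).prod (ν.tilted g))|
      ≤ 8 * h * k * M ^ 2 := by
  have := hr.isProbabilityMeasure
  have := hf.isProbabilityMeasure
  have := hg.isProbabilityMeasure
  have i1 := integrable_prod hV hr hf hΦ hΦb
  have i2 := integrable_prod hV hr hg hΦ hΦb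
  rw [integral_prod _ i1, integral_prod _ i2, ← integral_sub i1.integral_prod_left
    i2.integral_prod_left, ← Real.norm_eq_abs]
  refine (norm_integral_le_of_norm_le
    (((hr.integrable hV).add (integrable_const M)).const_mul (4 * h * k * M))
    (Eventually.of_forall fun x => ?_)).trans ?_
  · exact abs_integral_sub_le hV hM hf hg hh hfg (hΦ.comp measurable_prodMk_left)
      (V x).2 hk (fun y => hΦb (x, y))
  · rw [integral_const_mul]
    simp only [Pi.add_apply]
    rw [integral_add (hr.integrable hV) (integrable_const M)]
    simp only [integral_const, probReal_univ, smul_eq_mul, one_mul]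
    have : 0 ≤ 4 * h * k * M := by positivity
    nlinarith [hr.integral_le]

/-- The two factors are exchanged one at a time, the first by applying the previous bound to `Φ ∘
Prod.swap`. -/
lemma abs_integral_prod_sub_le (hV : Measurable V) (hM : 1 ≤ M)
    (hf : MomentBound ν V M f) (hg : MomentBound ν V M g)
    (hh : 0 ≤ h) (hfg : IncrementBound V h f g) {Φ : X × X → ℝ} (hΦ : Measurable Φ)
    (hk : 0 ≤ k) (hΦb : ∀ p, |Φ p| ≤ k * (V p.1 + V p.2)) :
    |∫ p, Φ p ∂((ν.tilted f).prod (ν.tilted f)) - ∫ p, Φ p ∂((ν.tilted g).prod (ν.tilted g))|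
      ≤ 16 * h * k * M ^ 2 := by
  have := hf.isProbabilityMeasure
  have := hg.isProbabilityMeasure
  have h1 := abs_integral_prod_sub_right_le hV hM hf hf hg hh hfg hΦ hk hΦb
  have h2 := abs_integral_prod_sub_right_le hV hM hg hf hg hh hfg (hΦ.comp measurable_swap) hk
    (fun p => (hΦb p.swap).trans (le_of_eq (by simp [add_comm])))
  simp only [Function.comp_apply] at h2
  rw [integral_prod_swap, integral_prod_swap] at h2
  have := abs_sub_le (∫ p, Φ p ∂((ν.tilted f).prod (ν.tilted f)))
    (∫ p, Φ p ∂((ν.tilted f).prod (ν.tilted g))) (∫ p, Φ p ∂((ν.tilted g).prod (ν.tilted g)))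
  linarith

end MomentBound

end Annealing
end

/-! ### Rejection and secant means up to second-order errors -/

noncomputable section

namespace Annealing

variable {X : Type*} [MeasurableSpace X]
variable {ν : Measure X} {V : X → ℝ≥0} {M h k c : ℝ} {f g r : X → ℝ}

namespace MomentBound

variable [NeZero ν]

lemma tiltedDensity_eq_exp (hf : Integrable (fun x => Real.exp (f x)) ν) :
    ∀ x, tiltedDensity ν f x = Real.exp (f x - Real.log (∫ y, Real.exp (f y) ∂ν)) := by
  intro x
  rw [Real.exp_sub, Real.exp_log (integral_exp_pos hf), tiltedDensity]

/-- The densities on the segment between two nearby exponents are dominated by those of the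
endpoints. -/
lemma density_secant_le (hV : Measurable V) (hf : MomentBound ν V M f) (hg : MomentBound ν V M g)
    (hh : 0 ≤ h) (hfg : IncrementBound V h f g) (hMh : 8 * M * h ≤ 1) {s : ℝ}
    (hs : s ∈ Icc (0 : ℝ) 1) :
    Integrable (fun x => Real.exp ((1 - s) * f x + s * g x)) ν ∧
    ∀ x, tiltedDensity ν (fun x => (1 - s) * f x + s * g x) x
      ≤ 2 * (tiltedDensity ν f x + tiltedDensity ν g x) := by
  obtain ⟨hs0, hs1⟩ := hs
  have hfm := hf.measurable
  have hgm := hg.measurable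
  set p := tiltedDensity ν f with hp
  set q := tiltedDensity ν g with hq
  have hp0 := tiltedDensity_pos hf.integrable_exp
  have hq0 := tiltedDensity_pos hg.integrable_exp
  set a : X → ℝ := fun x => f x - Real.log (∫ y, Real.exp (f y) ∂ν) with ha
  set b : X → ℝ := fun x => g x - Real.log (∫ y, Real.exp (g y) ∂ν) with hb
  have hpa : ∀ x, p x = Real.exp (a x) := tiltedDensity_eq_exp hf.integrable_exp
  have hqb : ∀ x, q x = Real.exp (b x) := tiltedDensity_eq_exp hg.integrable_exp
  -- Passing to the normalized exponents `a`, `b` changes the interpolated weight only by the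
  -- constant `κ`, which cancels in the density. The new weight is a geometric mean of `p` and `q`:
  -- it lies between `min p q` and `p + q`.
  set κ : ℝ := Real.exp ((1 - s) * Real.log (∫ y, Real.exp (f y) ∂ν)
    + s * Real.log (∫ y, Real.exp (g y) ∂ν)) with hκ
  have hκ0 : 0 < κ := Real.exp_pos _
  have hu : ∀ x, Real.exp ((1 - s) * f x + s * g x)
      = κ * Real.exp ((1 - s) * a x + s * b x) := by
    intro x
    rw [hκ, ← Real.exp_add]
    congr 1
    simp only [ha, hb]
    ring
  have hle : ∀ x, Real.exp ((1 - s) * a x + s * b x) ≤ p x + q x := by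
    intro x
    have h1 := convexOn_exp.2 (mem_univ (a x)) (mem_univ (b x)) (sub_nonneg.2 hs1) hs0 (by ring)
    simp only [smul_eq_mul] at h1
    rw [← hpa, ← hqb] at h1
    nlinarith [(hp0 x).le, (hq0 x).le]
  have hge : ∀ x, p x - h * ((V x + M) * (p x + q x)) ≤ Real.exp ((1 - s) * a x + s * b x) := by
    intro x
    have h1 := abs_density_sub_le hV hf hg hh hfg x
    have h2 := (abs_le.1 h1).2
    have h3 : min (p x) (q x) ≤ Real.exp ((1 - s) * a x + s * b x) := by
      rw [hpa, hqb]
      rcases le_total (a x) (b x) with h | h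
      · refine (min_le_left _ _).trans (Real.exp_le_exp.2 ?_)
        nlinarith
      · refine (min_le_right _ _).trans (Real.exp_le_exp.2 ?_)
        nlinarith
    refine le_trans (le_min ?_ ?_) h3
    · have : 0 ≤ h * ((V x + M) * (p x + q x)) :=
        (abs_nonneg _).trans h1
      linarith
    · linarith
  have ipq : Integrable (fun x => p x + q x) ν := hf.integrable_density.add hg.integrable_density
  have iu : Integrable (fun x => Real.exp ((1 - s) * a x + s * b x)) ν := by
    refine ipq.mono' (by fun_prop) (Eventually.of_forall fun x => ?_)
    rw [Real.norm_of_nonneg (Real.exp_pos _).le]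
    exact hle x
  -- The lower bound `hge` integrates to at least `1 - 4 * M * h`, which `hMh` keeps above one half;
  -- this is the origin of the factor 2 in the conclusion.
  have hlow : 1 / 2 ≤ ∫ x, Real.exp ((1 - s) * a x + s * b x) ∂ν := by
    have i0 : Integrable (fun x => p x * V x + q x * V x) ν :=
      (hf.integrable_density_mul hV).add (hg.integrable_density_mul hV)
    have i1 : Integrable (fun x => (p x * V x + q x * V x) + M * (p x + q x)) ν :=
      i0.add (ipq.const_mul M)
    have i2 : Integrable (fun x => p x - h * ((p x * V x + q x * V x) + M * (p x + q x))) ν :=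
      hf.integrable_density.sub (i1.const_mul h)
    have h1 := integral_mono i2 iu (fun x => by
      refine le_trans (le_of_eq ?_) (hge x)
      ring)
    refine le_trans ?_ h1
    rw [integral_sub hf.integrable_density (i1.const_mul h), integral_const_mul h,
      integral_add i0 (ipq.const_mul M),
      integral_add (hf.integrable_density_mul hV) (hg.integrable_density_mul hV),
      integral_const_mul M, integral_add hf.integrable_density hg.integrable_density,
      hf.integral_density, hg.integral_density]
    have h2 := hf.integral_density_mul_le
    have h3 := hg.integral_density_mul_le
    nlinarith
  refine ⟨by simpa only [hu] using iu.const_mul κ, fun x => ?_⟩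
  simp only [tiltedDensity, hu]
  rw [integral_const_mul, mul_div_mul_left _ _ hκ0.ne', div_le_iff₀ (by linarith)]
  nlinarith [hle x, (hp0 x).le, (hq0 x).le]

lemma secant (hV : Measurable V) (hf : MomentBound ν V M f) (hg : MomentBound ν V M g)
    (hh : 0 ≤ h) (hfg : IncrementBound V h f g) (hMh : 8 * M * h ≤ 1) {s : ℝ}
    (hs : s ∈ Icc (0 : ℝ) 1) :
    MomentBound ν V (4 * M) (fun x => (1 - s) * f x + s * g x) := by
  obtain ⟨hi, hle⟩ := density_secant_le hV hf hg hh hfg hMh hs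
  have hfm := hf.measurable
  have hgm := hg.measurable
  have hm : Measurable (fun x => (1 - s) * f x + s * g x) := by fun_prop
  have hu0 := tiltedDensity_pos hi
  have key : ∀ φ : X → ℝ, Measurable φ → (∀ x, 0 ≤ φ x) → Integrable φ (ν.tilted f) →
      Integrable φ (ν.tilted g) → ∫ x, φ x ∂(ν.tilted f) ≤ M → ∫ x, φ x ∂(ν.tilted g) ≤ M →
      Integrable φ (ν.tilted (fun x => (1 - s) * f x + s * g x)) ∧
      ∫ x, φ x ∂(ν.tilted (fun x => (1 - s) * f x + s * g x)) ≤ 4 * M := by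
    intro φ hφ hφ0 i1 i2 h1 h2
    rw [integrable_tilted_iff_mul hf.integrable_exp] at i1
    rw [integrable_tilted_iff_mul hg.integrable_exp] at i2
    rw [integrable_tilted_iff_mul hi, integral_tilted_eq]
    rw [integral_tilted_eq] at h1 h2
    have i3 : Integrable (fun x => 2 * (tiltedDensity ν f x * φ x + tiltedDensity ν g x * φ x)) ν :=
      (i1.add i2).const_mul 2
    have hb : ∀ x, tiltedDensity ν (fun x => (1 - s) * f x + s * g x) x * φ x
        ≤ 2 * (tiltedDensity ν f x * φ x + tiltedDensity ν g x * φ x) := fun x => by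
      nlinarith [mul_le_mul_of_nonneg_right (hle x) (hφ0 x)]
    have i4 : Integrable
        (fun x => tiltedDensity ν (fun x => (1 - s) * f x + s * g x) x * φ x) ν := by
      refine i3.mono' ?_ (Eventually.of_forall fun x => ?_)
      · unfold tiltedDensity
        fun_prop
      · rw [Real.norm_of_nonneg (mul_nonneg (hu0 x).le (hφ0 x))]
        exact hb x
    refine ⟨i4, (integral_mono i4 i3 hb).trans ?_⟩
    rw [integral_const_mul, integral_add i1 i2]
    linarith
  have k1 := key (fun x => (V x : ℝ)) (by fun_prop) (fun x => (V x).2) (hf.integrable hV)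
    (hg.integrable hV) hf.integral_le hg.integral_le
  have k2 := key (fun x => (V x : ℝ) ^ 2) (by fun_prop) (fun x => sq_nonneg _) hf.integrable_sq
    hg.integrable_sq hf.integral_sq_le hg.integral_sq_le
  exact ⟨hm, hi, k2.1, k1.2, k2.2⟩

end MomentBound

variable [NeZero ν]

/-- Swapping the two independent samples exchanges the positive and negative parts of `A`, so each
has half the mean of `|A|`. -/
lemma integral_neg_min_eq_half {P : Measure X} [IsProbabilityMeasure P] {A : X × X → ℝ}
    (hA : Integrable A (P.prod P)) (hanti : ∀ p, A p.swap = -A p) :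
    ∫ p, -min 0 (A p) ∂(P.prod P) = 1 / 2 * ∫ p, |A p| ∂(P.prod P) := by
  have i1 : Integrable (fun p => -min 0 (A p)) (P.prod P) := ((integrable_zero _ _ _).inf hA).neg
  have h1 : ∫ p, -min 0 (A p) ∂(P.prod P) = ∫ p, -min 0 (-A p) ∂(P.prod P) := by
    rw [← integral_prod_swap]
    simp only [hanti]
  have i2 : Integrable (fun p => -min 0 (-A p)) (P.prod P) :=
    ((integrable_zero _ _ _).inf hA.neg).neg
  have h2 : ∫ p, |A p| ∂(P.prod P)
      = ∫ p, -min 0 (A p) ∂(P.prod P) + ∫ p, -min 0 (-A p) ∂(P.prod P) := by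
    rw [← integral_add i1 i2]
    refine integral_congr_ae (Eventually.of_forall fun p => ?_)
    simp only
    rcases le_total 0 (A p) with h | h
    · rw [abs_of_nonneg h, min_eq_left h, min_eq_right (by linarith)]; ring
    · rw [abs_of_nonpos h, min_eq_right h, min_eq_left (by linarith)]; ring
  rw [h2, ← h1]; ring

lemma abs_one_sub_exp_add_le {m : ℝ} (hm : m ≤ 0) : |(1 - Real.exp m) - -m| ≤ m ^ 2 := by
  have h1 := Real.add_one_le_exp m
  have h2 : Real.exp m ≤ 1 + m + m ^ 2 := by
    have h3 := Real.add_one_le_exp (-m)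
    have h4 : Real.exp m * Real.exp (-m) = 1 := by rw [← Real.exp_add]; simp
    have h5 := Real.exp_pos m
    have h6 : Real.exp m * (1 - m) ≤ 1 := by nlinarith
    -- `(1 + m + m²)(1 - m) = 1 - m³ ≥ 1`, to be compared with `h6`.
    have h7 : m ^ 3 ≤ 0 := by nlinarith [sq_nonneg m]
    by_contra! h8
    nlinarith
  rw [abs_le]
  constructor <;> linarith

/-- To first order in the increments of the exponents, the mean rejection probability is half the
mean absolute value of the swap exponent. -/
lemma abs_rejection_sub_le (hV : Measurable V) (hM : 1 ≤ M) (hf : MomentBound ν V M f)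
    (hg : MomentBound ν V M g) (hh : 0 ≤ h) (hfg : IncrementBound V h f g) :
    |(1 - ∫ p : X × X, Real.exp (min 0 ((g p.1 - f p.1) - (g p.2 - f p.2)))
        ∂((ν.tilted f).prod (ν.tilted g)))
      - 1 / 2 * ∫ p : X × X, |(g p.1 - f p.1) - (g p.2 - f p.2)|
        ∂((ν.tilted f).prod (ν.tilted f))| ≤ 12 * M ^ 2 * h ^ 2 := by
  have := hf.isProbabilityMeasure
  have := hg.isProbabilityMeasure
  have hfm := hf.measurable
  have hgm := hg.measurable
  set A : X × X → ℝ := fun p => (g p.1 - f p.1) - (g p.2 - f p.2) with hA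
  have hAm : Measurable A := by fun_prop
  have hAb : ∀ p, |A p| ≤ h * (V p.1 + V p.2) := fun p => hfg p.1 p.2
  have hm : ∀ p, |-min 0 (A p)| ≤ |A p| := fun p => by
    rw [abs_neg]
    rcases le_total 0 (A p) with h | h
    · rw [min_eq_left h]; simp
    · rw [min_eq_right h]
  have hmm : Measurable (fun p => -min 0 (A p)) := by fun_prop
  have hmb : ∀ p, |-min 0 (A p)| ≤ h * (V p.1 + V p.2) := fun p => (hm p).trans (hAb p)
  have im := MomentBound.integrable_prod hV hf hg hmm hmb
  have ie : Integrable (fun p => 1 - Real.exp (min 0 (A p)))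
      ((ν.tilted f).prod (ν.tilted g)) := by
    refine (integrable_const (1 : ℝ)).mono' (by fun_prop) (Eventually.of_forall fun p => ?_)
    have h1 := Real.exp_pos (min 0 (A p))
    have h2 : Real.exp (min 0 (A p)) ≤ 1 := Real.exp_le_one_iff.2 (min_le_left _ _)
    rw [Real.norm_eq_abs, abs_le]
    constructor <;> linarith
  have ie' : Integrable (fun p => Real.exp (min 0 (A p))) ((ν.tilted f).prod (ν.tilted g)) := by
    refine ((integrable_const (1 : ℝ)).sub ie).congr (Eventually.of_forall fun p => ?_)
    simp
  have e1 : 1 - ∫ p, Real.exp (min 0 (A p)) ∂((ν.tilted f).prod (ν.tilted g))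
      = ∫ p, (1 - Real.exp (min 0 (A p))) ∂((ν.tilted f).prod (ν.tilted g)) := by
    rw [integral_sub (integrable_const 1) ie']; simp
  have i1 : Integrable (fun p : X × X => (V p.1 : ℝ) ^ 2) ((ν.tilted f).prod (ν.tilted g)) :=
    hf.integrable_sq.comp_fst _
  have i2 : Integrable (fun p : X × X => (V p.2 : ℝ) ^ 2) ((ν.tilted f).prod (ν.tilted g)) :=
    hg.integrable_sq.comp_snd _
  -- Linearizing the exponential costs `4 * M * h²`; replacing the second law by the first (`b2`)
  -- costs `8 * M² * h²`; symmetrization (`b3`) is exact. Together they give the constant 12.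
  have b1 : |(1 - ∫ p, Real.exp (min 0 (A p)) ∂((ν.tilted f).prod (ν.tilted g)))
      - ∫ p, -min 0 (A p) ∂((ν.tilted f).prod (ν.tilted g))| ≤ 4 * M * h ^ 2 := by
    rw [e1, ← integral_sub ie im, ← Real.norm_eq_abs]
    refine (norm_integral_le_of_norm_le ((i1.add i2).const_mul (2 * h ^ 2))
      (Eventually.of_forall fun p => ?_)).trans ?_
    · refine (abs_one_sub_exp_add_le (min_le_left 0 (A p))).trans ?_
      have h1 := hmb p
      rw [abs_neg] at h1
      rw [← sq_abs]
      have h2 : |min 0 (A p)| ^ 2 ≤ (h * (V p.1 + V p.2)) ^ 2 :=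
        pow_le_pow_left₀ (abs_nonneg _) h1 2
      refine h2.trans ?_
      simp only [Pi.add_apply]
      nlinarith [mul_nonneg (sq_nonneg h) (sq_nonneg ((V p.1 : ℝ) - V p.2))]
    · rw [integral_const_mul]
      simp only [Pi.add_apply]
      rw [integral_add i1 i2, integral_fun_fst (fun x => (V x : ℝ) ^ 2),
        integral_fun_snd (fun x => (V x : ℝ) ^ 2)]
      simp only [probReal_univ, one_smul]
      nlinarith [hf.integral_sq_le, hg.integral_sq_le, sq_nonneg h]
  have b2 := MomentBound.abs_integral_prod_sub_right_le hV hM hf hf hg hh hfg hmm hh hmb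
  have b3 := integral_neg_min_eq_half (P := ν.tilted f)
    (MomentBound.integrable_prod hV hf hf hAm hAb) (fun p => by simp [hA])
  rw [b3] at b2
  have b4 := abs_sub_le (1 - ∫ p, Real.exp (min 0 (A p)) ∂((ν.tilted f).prod (ν.tilted g)))
    (∫ p, -min 0 (A p) ∂((ν.tilted f).prod (ν.tilted g)))
    (1 / 2 * ∫ p, |A p| ∂((ν.tilted f).prod (ν.tilted f)))
  rw [abs_sub_comm] at b2
  nlinarith [sq_nonneg h, mul_nonneg (sq_nonneg h) (by nlinarith : (0 : ℝ) ≤ M ^ 2 - M)]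

/-- To first order in the increments of the exponents, the mean absolute swap exponent along the
segment between two exponents is the one at its starting point. -/
lemma abs_secant_integral_sub_le (hV : Measurable V) (hM : 1 ≤ M) (hf : MomentBound ν V M f)
    (hg : MomentBound ν V M g) (hh : 0 ≤ h) (hfg : IncrementBound V h f g)
    (hMh : 8 * M * h ≤ 1) :
    |1 / 2 * (∫ s in (0 : ℝ)..1, ∫ p : X × X, |(g p.1 - f p.1) - (g p.2 - f p.2)|
        ∂((ν.tilted (fun x => (1 - s) * f x + s * g x)).prod
          (ν.tilted (fun x => (1 - s) * f x + s * g x))))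
      - 1 / 2 * ∫ p : X × X, |(g p.1 - f p.1) - (g p.2 - f p.2)|
        ∂((ν.tilted f).prod (ν.tilted f))| ≤ 128 * M ^ 2 * h ^ 2 := by
  have hfm := hf.measurable
  have hgm := hg.measurable
  set A : X × X → ℝ := fun p => |(g p.1 - f p.1) - (g p.2 - f p.2)| with hA
  have hAm : Measurable A := by fun_prop
  have hAb : ∀ p, |A p| ≤ h * (V p.1 + V p.2) := fun p => by
    simp only [hA, abs_abs]; exact hfg p.1 p.2
  set G : ℝ → ℝ := fun s => ∫ p, A p ∂((ν.tilted (fun x => (1 - s) * f x + s * g x)).prod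
          (ν.tilted (fun x => (1 - s) * f x + s * g x))) with hG
  -- Exponents at `s` and `s'` on the segment have increments within `|s - s'| * h`, and the moment
  -- bound there is `4 * M`; hence `256 = 16 * 4²`.
  have hGl : ∀ s ∈ Icc (0 : ℝ) 1, ∀ s' ∈ Icc (0 : ℝ) 1,
      |G s - G s'| ≤ 256 * M ^ 2 * h ^ 2 * |s - s'| := by
    intro s hs s' hs'
    have h1 := MomentBound.abs_integral_prod_sub_le hV (by linarith : 1 ≤ 4 * M)
      (hf.secant hV hg hh hfg hMh hs) (hf.secant hV hg hh hfg hMh hs')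
      (h := |s - s'| * h) (by positivity) (fun x y => ?_) hAm hh hAb
    · refine h1.trans (le_of_eq ?_)
      ring
    · have e : (1 - s') * f x + s' * g x - ((1 - s) * f x + s * g x)
          - ((1 - s') * f y + s' * g y - ((1 - s) * f y + s * g y))
          = (s' - s) * ((g x - f x) - (g y - f y)) := by ring
      rw [e, abs_mul, abs_sub_comm, mul_assoc]
      exact mul_le_mul_of_nonneg_left (hfg x y) (abs_nonneg _)
  have hG0 : G 0 = ∫ p, A p ∂((ν.tilted f).prod (ν.tilted f)) := by simp [hG]
  have hGc : ContinuousOn G (Icc 0 1) := by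
    have : LipschitzOnWith (Real.toNNReal (256 * M ^ 2 * h ^ 2)) G (Icc 0 1) := by
      refine LipschitzOnWith.of_dist_le_mul fun s hs s' hs' => ?_
      rw [Real.coe_toNNReal _ (by positivity)]
      exact hGl s hs s' hs'
    exact this.continuousOn
  have hGi : IntervalIntegrable G volume 0 1 := by
    apply ContinuousOn.intervalIntegrable
    rwa [uIcc_of_le zero_le_one]
  have e : (∫ s in (0 : ℝ)..1, G s) - G 0 = ∫ s in (0 : ℝ)..1, (G s - G 0) := by
    rw [intervalIntegral.integral_sub hGi (by simp)]; simp
  rw [← hG0, ← mul_sub, e, abs_mul]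
  have : ‖∫ s in (0 : ℝ)..1, (G s - G 0)‖ ≤ 256 * M ^ 2 * h ^ 2 * |(1 : ℝ) - 0| := by
    refine intervalIntegral.norm_integral_le_of_norm_le_const fun s hs => ?_
    rw [uIoc_of_le zero_le_one] at hs
    refine (hGl s ⟨hs.1.le, hs.2⟩ 0 ⟨le_rfl, zero_le_one⟩).trans ?_
    rw [sub_zero, abs_of_pos hs.1]
    have : 0 ≤ 256 * M ^ 2 * h ^ 2 := by positivity
    nlinarith [hs.2]
  rw [Real.norm_eq_abs] at this
  norm_num at this ⊢
  linarith

end Annealing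
end

/-! ### Lipschitz paths and the local limit `λ(t)` -/

noncomputable section

namespace Annealing

variable {X : Type*} [MeasurableSpace X]
variable {ν : Measure X} {V : X → ℝ≥0} {M : ℝ} {W : ℝ → X → ℝ} {a b c d t : ℝ}

/-- The pairs `(a, b)` with `a ≤ t ≤ b`, `a < b`, in `[0, 1]`, converging to `(t, t)`. -/
def straddle (t : ℝ) : Filter (ℝ × ℝ) :=
  𝓝[{q | q.1 ∈ Icc (0 : ℝ) 1 ∧ q.2 ∈ Icc (0 : ℝ) 1 ∧ q.1 ≤ t ∧ t ≤ q.2 ∧ q.1 < q.2}] (t, t)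

instance : (straddle t).IsCountablyGenerated := by unfold straddle; infer_instance

lemma eventually_straddle : ∀ᶠ q in straddle t,
    q.1 ∈ Icc (0 : ℝ) 1 ∧ q.2 ∈ Icc (0 : ℝ) 1 ∧ q.1 ≤ t ∧ t ≤ q.2 ∧ q.1 < q.2 :=
  self_mem_nhdsWithin

lemma tendsto_fst_straddle : Tendsto Prod.fst (straddle t) (𝓝[Icc 0 1] t) :=
  tendsto_nhdsWithin_iff.2 ⟨continuous_fst.continuousAt.tendsto.mono_left nhdsWithin_le_nhds,
    eventually_straddle.mono fun _ h => h.1⟩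

lemma tendsto_snd_straddle : Tendsto Prod.snd (straddle t) (𝓝[Icc 0 1] t) :=
  tendsto_nhdsWithin_iff.2 ⟨continuous_snd.continuousAt.tendsto.mono_left nhdsWithin_le_nhds,
    eventually_straddle.mono fun _ h => h.2.1⟩

lemma neBot_straddle (ht : t ∈ Icc (0 : ℝ) 1) : (straddle t).NeBot := by
  refine mem_closure_iff_nhdsWithin_neBot.1 (mem_closure_iff_seq_limit.2
    ⟨fun n => (t - t * (1 / ((n : ℝ) + 1)), t + (1 - t) * (1 / ((n : ℝ) + 1))), fun n => ?_, ?_⟩)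
  · obtain ⟨h0, h1⟩ := ht
    have hn : 0 < 1 / ((n : ℝ) + 1) := by positivity
    have hn1 : 1 / ((n : ℝ) + 1) ≤ 1 := by
      rw [div_le_one (by positivity)]
      linarith [(Nat.cast_nonneg n : (0 : ℝ) ≤ n)]
    simp only [mem_ofPred_eq, mem_Icc]
    refine ⟨⟨?_, ?_⟩, ⟨?_, ?_⟩, ?_, ?_, ?_⟩ <;> nlinarith
  · have h := tendsto_one_div_add_atTop_nhds_zero_nat (𝕜 := ℝ)
    have h1 := (h.const_mul t).const_sub t
    have h2 := (h.const_mul (1 - t)).const_add t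
    simp only [mul_zero, sub_zero, add_zero] at h1 h2
    exact h1.prodMk_nhds h2

/-- The slope over intervals shrinking to `t` converges to the derivative at `t`. -/
lemma tendsto_slope_straddle {f : ℝ → ℝ} {f' : ℝ} (hf : HasDerivWithinAt f f' (Icc 0 1) t) :
    Tendsto (fun q : ℝ × ℝ => (f q.2 - f q.1) / (q.2 - q.1)) (straddle t) (𝓝 f') := by
  have ho := hasDerivWithinAt_iff_isLittleO.1 hf
  -- As `t` lies between the endpoints, both `b - t` and `t - a` are at most `b - a`, so each Taylor
  -- remainder is `o(b - a)`.
  have o1 := (ho.comp_tendsto (tendsto_snd_straddle (t := t))).trans_isBigO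
    (k := fun q : ℝ × ℝ => q.2 - q.1) (Asymptotics.IsBigO.of_bound 1 (by
      filter_upwards [eventually_straddle (t := t)] with q hq
      simp only [Function.comp_apply, Real.norm_eq_abs, one_mul]
      rw [abs_of_nonneg, abs_of_nonneg] <;> linarith [hq.2.2.1, hq.2.2.2.1]))
  have o2 := (ho.comp_tendsto (tendsto_fst_straddle (t := t))).trans_isBigO
    (k := fun q : ℝ × ℝ => q.2 - q.1) (Asymptotics.IsBigO.of_bound 1 (by
      filter_upwards [eventually_straddle (t := t)] with q hq
      simp only [Function.comp_apply, Real.norm_eq_abs, one_mul]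
      rw [abs_of_nonpos, abs_of_nonneg] <;> linarith [hq.2.2.1, hq.2.2.2.1]))
  have h := ((o1.sub o2).tendsto_div_nhds_zero).add_const f'
  rw [zero_add] at h
  refine h.congr' ?_
  filter_upwards [eventually_straddle (t := t)] with q hq
  have : q.2 - q.1 ≠ 0 := by linarith [hq.2.2.2.2]
  simp only [Function.comp_apply, smul_eq_mul]
  field_simp
  ring

/-- Half the mean absolute swap exponent between `a` and `b`, for two independent samples at `c`. -/
def meanSwap (ν : Measure X) (W : ℝ → X → ℝ) (c a b : ℝ) : ℝ :=
  1 / 2 * ∫ p : X × X, |swapExponent W a b p.1 p.2| ∂((law ν W c).prod (law ν W c))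

lemma meanSwap_comm : meanSwap ν W c a b = meanSwap ν W c b a := by
  have : ∀ p : X × X, |swapExponent W a b p.1 p.2| = |swapExponent W b a p.1 p.2| := fun p => by
    rw [← abs_neg]; simp only [swapExponent]; ring_nf
  simp only [meanSwap, this]

lemma meanSwap_nonneg : 0 ≤ meanSwap ν W c a b :=
  mul_nonneg (by norm_num) (integral_nonneg fun _ => abs_nonneg _)

/-- A path of exponents on `[0, 1]` along which the first two moments of `V` are bounded by `M`, and
whose increments in time have increments in space bounded by `V`. -/
structure LipschitzPath (ν : Measure X) (V : X → ℝ≥0) (M : ℝ) (W : ℝ → X → ℝ) : Prop where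
  measurable_bound : Measurable V
  one_le : 1 ≤ M
  moment : ∀ t ∈ Icc (0 : ℝ) 1, MomentBound ν V M (W t)
  increment : ∀ a ∈ Icc (0 : ℝ) 1, ∀ b ∈ Icc (0 : ℝ) 1, IncrementBound V |b - a| (W a) (W b)

namespace LipschitzPath

lemma measurable_swapExponent (hW : LipschitzPath ν V M W) (ha : a ∈ Icc (0 : ℝ) 1)
    (hb : b ∈ Icc (0 : ℝ) 1) : Measurable fun p : X × X => swapExponent W a b p.1 p.2 := by
  have h1 := (hW.moment a ha).measurable
  have h2 := (hW.moment b hb).measurable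
  unfold swapExponent
  fun_prop

lemma abs_swapExponent_le (hW : LipschitzPath ν V M W) (ha : a ∈ Icc (0 : ℝ) 1)
    (hb : b ∈ Icc (0 : ℝ) 1) (p : X × X) :
    |swapExponent W a b p.1 p.2| ≤ |b - a| * (V p.1 + V p.2) := hW.increment a ha b hb p.1 p.2

variable [NeZero ν]

lemma isProbabilityMeasure_law (hW : LipschitzPath ν V M W) (ht : t ∈ Icc (0 : ℝ) 1) :
    IsProbabilityMeasure (law ν W t) := (hW.moment t ht).isProbabilityMeasure

lemma meanSwap_le (hW : LipschitzPath ν V M W) (hc : c ∈ Icc (0 : ℝ) 1)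
    (ha : a ∈ Icc (0 : ℝ) 1) (hb : b ∈ Icc (0 : ℝ) 1) : meanSwap ν W c a b ≤ |b - a| * M := by
  have h := (abs_le.1 (MomentBound.abs_integral_prod_le hW.measurable_bound (hW.moment c hc)
    (hW.moment c hc) (Φ := fun p => |swapExponent W a b p.1 p.2|) (abs_nonneg (b - a))
    (fun p => by rw [abs_abs]; exact hW.abs_swapExponent_le ha hb p))).2
  unfold meanSwap law
  linarith

lemma abs_meanSwap_sub_le (hW : LipschitzPath ν V M W) (hc : c ∈ Icc (0 : ℝ) 1)
    (hd : d ∈ Icc (0 : ℝ) 1) (ha : a ∈ Icc (0 : ℝ) 1) (hb : b ∈ Icc (0 : ℝ) 1) :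
    |meanSwap ν W c a b - meanSwap ν W d a b| ≤ 8 * |d - c| * |b - a| * M ^ 2 := by
  have h := MomentBound.abs_integral_prod_sub_le hW.measurable_bound hW.one_le (hW.moment c hc)
    (hW.moment d hd) (abs_nonneg (d - c)) (hW.increment c hc d hd)
    (Φ := fun p => |swapExponent W a b p.1 p.2|)
    (by simpa using (hW.measurable_swapExponent ha hb).abs) (abs_nonneg (b - a))
    (fun p => by rw [abs_abs]; exact hW.abs_swapExponent_le ha hb p)
  unfold meanSwap law
  rw [← mul_sub, abs_mul, abs_of_pos (by norm_num : (0 : ℝ) < 1 / 2)]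
  linarith

lemma abs_rejection_sub_meanSwap_le (hW : LipschitzPath ν V M W)
    (ha : a ∈ Icc (0 : ℝ) 1) (hb : b ∈ Icc (0 : ℝ) 1) :
    |rejection ν W a b - meanSwap ν W a a b| ≤ 12 * M ^ 2 * (b - a) ^ 2 := by
  have h := abs_rejection_sub_le hW.measurable_bound hW.one_le (hW.moment a ha)
    (hW.moment b hb) (abs_nonneg (b - a)) (hW.increment a ha b hb)
  rw [sq_abs] at h
  exact h

lemma abs_secantBarrier_sub_meanSwap_le (hW : LipschitzPath ν V M W)
    (ha : a ∈ Icc (0 : ℝ) 1) (hb : b ∈ Icc (0 : ℝ) 1) (hab : 8 * M * |b - a| ≤ 1) :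
    |secantBarrier ν W a b - meanSwap ν W a a b| ≤ 128 * M ^ 2 * (b - a) ^ 2 := by
  have h := abs_secant_integral_sub_le hW.measurable_bound hW.one_le (hW.moment a ha)
    (hW.moment b hb) (abs_nonneg (b - a)) (hW.increment a ha b hb) hab
  rw [sq_abs] at h
  exact h

/-- The mean absolute swap exponent across short intervals around `t` is asymptotically `λ(t)` times
their length, if almost every exponent is differentiable at `t`. -/
lemma tendsto_meanSwap_div (hW : LipschitzPath ν V M W) (ht : t ∈ Icc (0 : ℝ) 1)
    (hd : ∀ᵐ x ∂ν, DifferentiableWithinAt ℝ (fun u => W u x) (Icc (0 : ℝ) 1) t) :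
    Integrable (fun p : X × X => |dW W t p.1 - dW W t p.2|)
        ((law ν W t).prod (law ν W t)) ∧
      Tendsto (fun q : ℝ × ℝ => meanSwap ν W t q.1 q.2 / (q.2 - q.1)) (straddle t)
        (𝓝 (instRejection ν W t)) := by
  have := hW.isProbabilityMeasure_law ht
  have := neBot_straddle ht
  have hV := hW.measurable_bound
  set P := law ν W t with hP
  have hd' : ∀ᵐ x ∂P, DifferentiableWithinAt ℝ (fun u => W u x) (Icc (0 : ℝ) 1) t :=
    (tilted_absolutelyContinuous ν (W t)).ae_le hd
  have hd1 := Measure.quasiMeasurePreserving_fst (μ := P) (ν := P) |>.ae hd'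
  have hd2 := Measure.quasiMeasurePreserving_snd (μ := P) (ν := P) |>.ae hd'
  have hlim : ∀ᵐ p ∂(P.prod P), Tendsto
      (fun q : ℝ × ℝ => |swapExponent W q.1 q.2 p.1 p.2| / (q.2 - q.1)) (straddle t)
      (𝓝 |dW W t p.1 - dW W t p.2|) := by
    filter_upwards [hd1, hd2] with p h1 h2
    refine ((tendsto_slope_straddle h1.hasDerivWithinAt).sub
      (tendsto_slope_straddle h2.hasDerivWithinAt)).abs.congr' ?_
    filter_upwards [eventually_straddle (t := t)] with q hq
    have : 0 < q.2 - q.1 := sub_pos.2 hq.2.2.2.2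
    rw [← sub_div, abs_div, abs_of_pos this]
    rfl
  have hVi : Integrable (fun p : X × X => (V p.1 + V p.2 : ℝ)) (P.prod P) :=
    (((hW.moment t ht).integrable hV).comp_fst P).add (((hW.moment t ht).integrable hV).comp_snd P)
  have hbound : ∀ᶠ q in straddle t, ∀ p : X × X,
      |swapExponent W q.1 q.2 p.1 p.2| / (q.2 - q.1) ≤ V p.1 + V p.2 := by
    filter_upwards [eventually_straddle (t := t)] with q hq p
    have h0 : 0 < q.2 - q.1 := sub_pos.2 hq.2.2.2.2
    have h1 := hW.abs_swapExponent_le hq.1 hq.2.1 p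
    rw [abs_of_pos h0] at h1
    rw [div_le_iff₀ h0]
    linarith
  have hmeas : ∀ᶠ q in straddle t, AEStronglyMeasurable
      (fun p : X × X => |swapExponent W q.1 q.2 p.1 p.2| / (q.2 - q.1)) (P.prod P) := by
    filter_upwards [eventually_straddle (t := t)] with q hq
    exact ((hW.measurable_swapExponent hq.1 hq.2.1).abs.div_const _).aestronglyMeasurable
  have hnorm : ∀ᶠ q in straddle t, ∀ᵐ p ∂(P.prod P),
      ‖|swapExponent W q.1 q.2 p.1 p.2| / (q.2 - q.1)‖ ≤ V p.1 + V p.2 := by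
    filter_upwards [hbound, eventually_straddle (t := t)] with q hq hq'
    refine Eventually.of_forall fun p => ?_
    have h0 : 0 < q.2 - q.1 := sub_pos.2 hq'.2.2.2.2
    rw [Real.norm_of_nonneg (by positivity)]
    exact hq p
  constructor
  -- Measurability of the derivative comes from exhibiting it as an almost everywhere limit of a
  -- sequence of difference quotients. The shift by `n₀` discards terms for which measurability is
  -- not yet known.
  · obtain ⟨u, hu⟩ := (straddle t).exists_seq_tendsto
    obtain ⟨n₀, hn₀⟩ := eventually_atTop.1 (hu.eventually hmeas)
    have hu' : Tendsto (fun n => u (n + n₀)) atTop (straddle t) :=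
      hu.comp (tendsto_add_atTop_nat n₀)
    refine hVi.mono' (aestronglyMeasurable_of_tendsto_ae atTop
      (fun n => hn₀ (n + n₀) (Nat.le_add_left _ _)) (hlim.mono fun p hp => hp.comp hu')) ?_
    filter_upwards [hlim] with p hp
    rw [Real.norm_of_nonneg (abs_nonneg _)]
    exact le_of_tendsto hp (hbound.mono fun q hq => hq p)
  · have h := (tendsto_integral_filter_of_dominated_convergence _ hmeas hnorm hVi hlim).const_mul
      (1 / 2)
    refine h.congr fun q => ?_
    rw [integral_div, meanSwap]
    ring

lemma tendsto_rejection_div (hW : LipschitzPath ν V M W) (ht : t ∈ Icc (0 : ℝ) 1)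
    (hd : ∀ᵐ x ∂ν, DifferentiableWithinAt ℝ (fun u => W u x) (Icc (0 : ℝ) 1) t) :
    Tendsto (fun h : ℝ => rejection ν W (t + h) t / |h|)
      (𝓝[{h : ℝ | h ≠ 0 ∧ t + h ∈ Icc (0 : ℝ) 1}] 0) (𝓝 (instRejection ν W t)) := by
  have hmem : ∀ᶠ h : ℝ in 𝓝[{h : ℝ | h ≠ 0 ∧ t + h ∈ Icc (0 : ℝ) 1}] 0,
    h ≠ 0 ∧ t + h ∈ Icc (0 : ℝ) 1 := self_mem_nhdsWithin
  -- Ordering the endpoints treats both signs of `h` at once.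
  have h1 : Tendsto (fun h : ℝ => (min t (t + h), max t (t + h)))
      (𝓝[{h : ℝ | h ≠ 0 ∧ t + h ∈ Icc (0 : ℝ) 1}] 0) (straddle t) := by
    refine tendsto_nhdsWithin_iff.2 ⟨?_, ?_⟩
    · have : Continuous fun h : ℝ => (min t (t + h), max t (t + h)) := by fun_prop
      have h2 := (this.tendsto 0).mono_left
        (nhdsWithin_le_nhds (s := {h : ℝ | h ≠ 0 ∧ t + h ∈ Icc (0 : ℝ) 1}))
      simpa using h2
    · filter_upwards [hmem] with h hh
      obtain ⟨h0, hh⟩ := hh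
      refine ⟨⟨le_min ht.1 hh.1, (min_le_left _ _).trans ht.2⟩,
        ⟨ht.1.trans (le_max_left _ _), max_le ht.2 hh.2⟩, min_le_left _ _, le_max_left _ _, ?_⟩
      simpa [min_lt_max] using h0
  have h2 := (hW.tendsto_meanSwap_div ht hd).2.comp h1
  have h3 : Tendsto (fun h : ℝ => rejection ν W (t + h) t / |h|
      - meanSwap ν W t (min t (t + h)) (max t (t + h)) / |h|)
      (𝓝[{h : ℝ | h ≠ 0 ∧ t + h ∈ Icc (0 : ℝ) 1}] 0) (𝓝 0) := by
    -- `20 = 12 + 8`: rejection against `meanSwap` sampled at `t + h`, then moving the samples to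
    -- `t`.
    have h4 : Tendsto (fun h : ℝ => 20 * M ^ 2 * |h|)
        (𝓝[{h : ℝ | h ≠ 0 ∧ t + h ∈ Icc (0 : ℝ) 1}] 0) (𝓝 0) := by
      have : Continuous fun h : ℝ => 20 * M ^ 2 * |h| := by fun_prop
      simpa using (this.tendsto 0).mono_left
        (nhdsWithin_le_nhds (s := {h : ℝ | h ≠ 0 ∧ t + h ∈ Icc (0 : ℝ) 1}))
    refine squeeze_zero_norm' ?_ h4
    filter_upwards [hmem] with h hh
    obtain ⟨h0, hh⟩ := hh
    have habs : 0 < |h| := abs_pos.2 h0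
    have b1 := hW.abs_rejection_sub_meanSwap_le hh ht
    have b2 := hW.abs_meanSwap_sub_le hh ht hh ht
    have e : meanSwap ν W t (min t (t + h)) (max t (t + h)) = meanSwap ν W t (t + h) t := by
      rcases le_total t (t + h) with h' | h'
      · rw [min_eq_left h', max_eq_right h', meanSwap_comm]
      · rw [min_eq_right h', max_eq_left h']
    rw [show t - (t + h) = -h by ring] at b1 b2
    rw [abs_neg] at b2
    rw [neg_sq, ← sq_abs h] at b1
    rw [e, Real.norm_eq_abs, ← sub_div, abs_div, abs_abs, div_le_iff₀ habs]
    have b3 := abs_sub_le (rejection ν W (t + h) t) (meanSwap ν W (t + h) (t + h) t)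
      (meanSwap ν W t (t + h) t)
    nlinarith
  have h5 := h3.add h2
  rw [zero_add] at h5
  refine h5.congr fun h => ?_
  simp only [Function.comp_apply, max_sub_min_eq_abs]
  rw [show t + h - t = h by ring]
  ring

end LipschitzPath

end Annealing
end

/-! ### Sums over schedules as integrals of step functions -/

noncomputable section

namespace Annealing

variable {X : Type*} [MeasurableSpace X]
variable {ν : Measure X} {V : X → ℝ≥0} {M : ℝ} {W : ℝ → X → ℝ} {a b c d t : ℝ}

namespace Schedule

variable {N : ℕ} (T : Schedule N) (F : ℝ → ℝ → ℝ)

lemma pt_mem_Icc (i : Fin (N + 1)) : T.pt i ∈ Icc (0 : ℝ) 1 := by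
  constructor
  · rw [← T.zero]; exact T.monotone (Fin.zero_le i)
  · rw [← T.last]; exact T.monotone (Fin.le_last i)

lemma pt_castSucc_le (n : Fin N) : T.pt n.castSucc ≤ T.pt n.succ :=
  T.monotone (Fin.castSucc_le_succ n)

lemma gap_le_mesh (n : Fin N) : T.pt n.succ - T.pt n.castSucc ≤ T.mesh :=
  le_ciSup (f := fun n : Fin N => T.pt n.succ - T.pt n.castSucc)
    (Set.finite_range _).bddAbove n

lemma mesh_nonneg : 0 ≤ T.mesh :=
  Real.iSup_nonneg fun n => sub_nonneg.2 (T.pt_castSucc_le n)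

lemma exists_mem_Ioc (ht : t ∈ Ioc (0 : ℝ) 1) :
    ∃ n : Fin N, t ∈ Ioc (T.pt n.castSucc) (T.pt n.succ) := by
  by_contra! h
  have key : ∀ i, T.pt i < t := by
    intro i
    induction i using Fin.induction with
    | zero => rw [T.zero]; exact ht.1
    | succ i ih =>
      by_contra! h'
      exact h i ⟨ih, h'⟩
  have := key (Fin.last N)
  rw [T.last] at this
  exact absurd ht.2 (not_le.2 this)

/-- The step function on `(0, 1]` whose value on a cell `(a, b]` of the schedule is
`F a b / (b - a)`. -/
def step (t : ℝ) : ℝ :=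
  ∑ n : Fin N, (Ioc (T.pt n.castSucc) (T.pt n.succ)).indicator
    (fun _ => F (T.pt n.castSucc) (T.pt n.succ) / (T.pt n.succ - T.pt n.castSucc)) t

variable {T} in
lemma step_eq {n : Fin N} (hn : t ∈ Ioc (T.pt n.castSucc) (T.pt n.succ)) :
    T.step F t = F (T.pt n.castSucc) (T.pt n.succ) / (T.pt n.succ - T.pt n.castSucc) := by
  unfold step
  rw [Finset.sum_eq_single n, indicator_of_mem hn]
  · intro m _ hmn
    refine indicator_of_notMem (fun hm => ?_) _
    rcases lt_or_gt_of_ne hmn with h | h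
    · have : T.pt m.succ ≤ T.pt n.castSucc := T.monotone (by
        rw [Fin.le_def]; simpa using h)
      exact absurd (hm.2.trans this) (not_le.2 hn.1)
    · have : T.pt n.succ ≤ T.pt m.castSucc := T.monotone (by
        rw [Fin.le_def]; simpa using h)
      exact absurd (hn.2.trans this) (not_le.2 hm.1)
  · simp

lemma measurable_step : Measurable (T.step F) := by
  unfold step
  exact Finset.measurable_fun_sum _ fun n _ => measurable_const.indicator measurableSet_Ioc

lemma integral_step (hF : ∀ a ∈ Icc (0 : ℝ) 1, F a a = 0) :
    ∫ t in (0 : ℝ)..1, T.step F t = ∑ n : Fin N, F (T.pt n.castSucc) (T.pt n.succ) := by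
  rw [intervalIntegral.integral_of_le zero_le_one]
  unfold step
  rw [integral_finsetSum]
  · refine Finset.sum_congr rfl fun n _ => ?_
    have hsub : Ioc (0 : ℝ) 1 ∩ Ioc (T.pt n.castSucc) (T.pt n.succ)
        = Ioc (T.pt n.castSucc) (T.pt n.succ) :=
      inter_eq_right.2 (Ioc_subset_Ioc (T.pt_mem_Icc _).1 (T.pt_mem_Icc _).2)
    rw [setIntegral_indicator measurableSet_Ioc, hsub, setIntegral_const,
      Real.volume_real_Ioc_of_le (T.pt_castSucc_le n), smul_eq_mul]
    -- Schedules may repeat points: an empty cell contributes nothing to the integral, so its term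
    -- in the sum must vanish by `hF`.
    rcases (T.pt_castSucc_le n).eq_or_lt with h | h
    · rw [← h, hF _ (T.pt_mem_Icc _)]; simp
    · rw [mul_div_cancel₀]
      exact (sub_pos.2 h).ne'
  · intro n _
    exact (integrable_const _).indicator measurableSet_Ioc

/-- The equidistant schedule. -/
def uniform (k : ℕ) : Schedule (k + 1) where
  pt i := (i : ℝ) / (k + 1)
  monotone i j hij := by
    have : (i : ℝ) ≤ j := by exact_mod_cast hij
    exact div_le_div_of_nonneg_right this (by positivity)
  zero := by simp
  last := by
    simp only [Fin.val_last]
    push_cast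
    exact div_self (by positivity)

lemma mesh_uniform_le (k : ℕ) : (uniform k).mesh ≤ 1 / ((k : ℝ) + 1) := by
  refine ciSup_le fun n => le_of_eq ?_
  simp only [uniform, Fin.val_succ, Fin.val_castSucc]
  push_cast
  ring

end Schedule

namespace LipschitzPath

variable [NeZero ν] {F : ℝ → ℝ → ℝ} {C δ₀ : ℝ}

/-- The cell containing `t` straddles `t` and shrinks with the mesh. Replacing `F` by `meanSwap` and
moving the samples from the left endpoint to `t` each change the quotient by `O(mesh)`, which leaves
the local limit. -/
lemma tendsto_step (hW : LipschitzPath ν V M W) (hδ₀ : 0 < δ₀)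
    (hF : ∀ a ∈ Icc (0 : ℝ) 1, ∀ b ∈ Icc (0 : ℝ) 1, a ≤ b → b - a ≤ δ₀ →
      |F a b - meanSwap ν W a a b| ≤ C * (b - a) ^ 2)
    {N : ℕ → ℕ} (T : ∀ k, Schedule (N k)) (hT : Tendsto (fun k => (T k).mesh) atTop (𝓝 0))
    (ht : t ∈ Ioc (0 : ℝ) 1)
    (hd : ∀ᵐ x ∂ν, DifferentiableWithinAt ℝ (fun u => W u x) (Icc (0 : ℝ) 1) t) :
    Tendsto (fun k => (T k).step F t) atTop (𝓝 (instRejection ν W t)) := by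
  have ht' : t ∈ Icc (0 : ℝ) 1 := ⟨ht.1.le, ht.2⟩
  choose n hn using fun k => (T k).exists_mem_Ioc ht
  set a : ℕ → ℝ := fun k => (T k).pt (n k).castSucc with ha
  set b : ℕ → ℝ := fun k => (T k).pt (n k).succ with hb
  have ha1 : ∀ k, a k ∈ Icc (0 : ℝ) 1 := fun k => (T k).pt_mem_Icc _
  have hb1 : ∀ k, b k ∈ Icc (0 : ℝ) 1 := fun k => (T k).pt_mem_Icc _
  have hat : ∀ k, a k < t := fun k => (hn k).1
  have htb : ∀ k, t ≤ b k := fun k => (hn k).2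
  have hgap : ∀ k, b k - a k ≤ (T k).mesh := fun k => (T k).gap_le_mesh _
  have hq : Tendsto (fun k => (a k, b k)) atTop (straddle t) := by
    refine tendsto_nhdsWithin_iff.2 ⟨Tendsto.prodMk_nhds ?_ ?_, Eventually.of_forall fun k =>
      ⟨ha1 k, hb1 k, (hat k).le, htb k, (hat k).trans_le (htb k)⟩⟩
    · refine tendsto_iff_dist_tendsto_zero.2 (squeeze_zero (fun _ => dist_nonneg) (fun k => ?_) hT)
      rw [Real.dist_eq, abs_of_nonpos (by linarith [hat k])]
      linarith [htb k, hgap k]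
    · refine tendsto_iff_dist_tendsto_zero.2 (squeeze_zero (fun _ => dist_nonneg) (fun k => ?_) hT)
      rw [Real.dist_eq, abs_of_nonneg (by linarith [htb k])]
      linarith [hat k, hgap k]
  have h1 := (hW.tendsto_meanSwap_div ht' hd).2.comp hq
  have h2 : Tendsto (fun k => (T k).step F t - meanSwap ν W t (a k) (b k) / (b k - a k)) atTop
      (𝓝 0) := by
    have h3 := hT.const_mul (|C| + 8 * M ^ 2)
    rw [mul_zero] at h3
    refine squeeze_zero_norm' ?_ h3
    filter_upwards [hT.eventually (gt_mem_nhds hδ₀)] with k hk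
    have hpos : 0 < b k - a k := sub_pos.2 ((hat k).trans_le (htb k))
    rw [Schedule.step_eq F (hn k), Real.norm_eq_abs, ← sub_div, abs_div, abs_of_pos hpos,
      div_le_iff₀ hpos]
    have b1 := hF _ (ha1 k) _ (hb1 k) (sub_pos.1 hpos).le ((hgap k).trans hk.le)
    have b2 := hW.abs_meanSwap_sub_le (ha1 k) ht' (ha1 k) (hb1 k)
    rw [abs_of_pos hpos, abs_of_pos (sub_pos.2 (hat k))] at b2
    refine (abs_sub_le _ (meanSwap ν W (a k) (a k) (b k)) _).trans ?_
    have b3 : C * (b k - a k) ^ 2 ≤ |C| * ((T k).mesh * (b k - a k)) := by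
      refine mul_le_mul (le_abs_self C) ?_ (sq_nonneg _) (abs_nonneg C)
      rw [sq]
      exact mul_le_mul_of_nonneg_right (hgap k) hpos.le
    have b4 : 8 * (t - a k) * (b k - a k) * M ^ 2 ≤ 8 * (T k).mesh * (b k - a k) * M ^ 2 := by
      have : t - a k ≤ (T k).mesh := by linarith [htb k, hgap k]
      gcongr
    have : |F (a k) (b k) - meanSwap ν W (a k) (a k) (b k)| ≤ C * (b k - a k) ^ 2 := b1
    linarith
  have h5 := h2.add h1
  rw [zero_add] at h5
  refine h5.congr fun k => ?_
  simp

lemma abs_step_le (hW : LipschitzPath ν V M W)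
    (hF : ∀ a ∈ Icc (0 : ℝ) 1, ∀ b ∈ Icc (0 : ℝ) 1, a ≤ b → b - a ≤ δ₀ →
      |F a b - meanSwap ν W a a b| ≤ C * (b - a) ^ 2)
    {N : ℕ} (T : Schedule N) (hT : T.mesh ≤ δ₀) (ht : t ∈ Ioc (0 : ℝ) 1) :
    |T.step F t| ≤ |C| + M := by
  obtain ⟨n, hn⟩ := T.exists_mem_Ioc ht
  have ha := T.pt_mem_Icc n.castSucc
  have hb := T.pt_mem_Icc n.succ
  have hg := T.gap_le_mesh n
  rw [Schedule.step_eq F hn]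
  set a := T.pt n.castSucc
  set b := T.pt n.succ
  have hpos : 0 < b - a := sub_pos.2 (hn.1.trans_le hn.2)
  rw [abs_div, abs_of_pos hpos, div_le_iff₀ hpos]
  have b1 := hF a ha b hb (sub_pos.1 hpos).le (hg.trans hT)
  have b2 := hW.meanSwap_le ha ha hb
  rw [abs_of_pos hpos] at b2
  have b3 := abs_add_le (F a b - meanSwap ν W a a b) (meanSwap ν W a a b)
  rw [sub_add_cancel, abs_of_nonneg (meanSwap_nonneg (ν := ν))] at b3
  have b4 : C * (b - a) ^ 2 ≤ |C| * (b - a) := by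
    refine mul_le_mul (le_abs_self C) ?_ (sq_nonneg _) (abs_nonneg C)
    nlinarith [hb.2, ha.1]
  linarith

lemma intervalIntegrable_instRejection (hW : LipschitzPath ν V M W)
    (hd : ∀ᵐ t ∂(volume.restrict (Icc (0 : ℝ) 1)), ∀ᵐ x ∂ν,
      DifferentiableWithinAt ℝ (fun u => W u x) (Icc (0 : ℝ) 1) t) :
    IntervalIntegrable (instRejection ν W) volume 0 1 := by
  rw [intervalIntegrable_iff_integrableOn_Ioc_of_le zero_le_one]
  have hF : ∀ a ∈ Icc (0 : ℝ) 1, ∀ b ∈ Icc (0 : ℝ) 1, a ≤ b → b - a ≤ 1 →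
      |meanSwap ν W a a b - meanSwap ν W a a b| ≤ 0 * (b - a) ^ 2 := by
    intros; simp
  have hd' : ∀ᵐ t ∂(volume.restrict (Ioc (0 : ℝ) 1)), ∀ᵐ x ∂ν,
      DifferentiableWithinAt ℝ (fun u => W u x) (Icc (0 : ℝ) 1) t :=
    ae_mono (Measure.restrict_mono Ioc_subset_Icc_self le_rfl) hd
  -- Equidistant schedules present `λ` as an almost everywhere limit of uniformly bounded measurable
  -- step functions, giving measurability and integrability together.
  have hmesh : Tendsto (fun k => (Schedule.uniform k).mesh) atTop (𝓝 0) :=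
    squeeze_zero (fun k => Schedule.mesh_nonneg _) Schedule.mesh_uniform_le
      tendsto_one_div_add_atTop_nhds_zero_nat
  have hlim : ∀ᵐ t ∂(volume.restrict (Ioc (0 : ℝ) 1)), Tendsto
      (fun k => (Schedule.uniform k).step (fun a b => meanSwap ν W a a b) t) atTop
      (𝓝 (instRejection ν W t)) := by
    filter_upwards [hd', ae_restrict_mem measurableSet_Ioc] with t h1 h2
    exact hW.tendsto_step one_pos hF Schedule.uniform hmesh h2 h1
  refine (integrable_const (|0| + M)).mono' (aestronglyMeasurable_of_tendsto_ae atTop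
    (fun k => (Schedule.measurable_step _ _).aestronglyMeasurable) hlim) ?_
  filter_upwards [hlim, ae_restrict_mem measurableSet_Ioc] with t h1 h2
  refine le_of_tendsto h1.norm (Eventually.of_forall fun k => ?_)
  refine hW.abs_step_le hF _ ((Schedule.mesh_uniform_le k).trans ?_) h2
  rw [div_le_one (by positivity)]
  linarith [(Nat.cast_nonneg k : (0 : ℝ) ≤ k)]

/-- Riemann-type sums of any function that agrees with `meanSwap` to first order converge to the
global barrier, uniformly over schedules of small mesh. -/
lemma exists_mesh_abs_sum_sub_le (hW : LipschitzPath ν V M W)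
    (hd : ∀ᵐ t ∂(volume.restrict (Icc (0 : ℝ) 1)), ∀ᵐ x ∂ν,
      DifferentiableWithinAt ℝ (fun u => W u x) (Icc (0 : ℝ) 1) t) (hδ₀ : 0 < δ₀)
    (hF : ∀ a ∈ Icc (0 : ℝ) 1, ∀ b ∈ Icc (0 : ℝ) 1, a ≤ b → b - a ≤ δ₀ →
      |F a b - meanSwap ν W a a b| ≤ C * (b - a) ^ 2) {ε : ℝ} (hε : 0 < ε) :
    ∃ δ > 0, ∀ (N : ℕ) (T : Schedule N), T.mesh ≤ δ →
      |(∑ n : Fin N, F (T.pt n.castSucc) (T.pt n.succ)) - globalBarrier ν W| ≤ ε := by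
  -- Uniformity over schedules by contradiction: failure yields a sequence of bad schedules with
  -- mesh tending to zero, to which dominated convergence applies.
  by_contra! h
  have hpos : ∀ k : ℕ, 0 < min δ₀ (1 / ((k : ℝ) + 1)) := fun k => lt_min hδ₀ (by positivity)
  choose N T hT hlt using fun k => h _ (hpos k)
  have hmesh : Tendsto (fun k => (T k).mesh) atTop (𝓝 0) :=
    squeeze_zero (fun k => Schedule.mesh_nonneg _) (fun k => (hT k).trans (min_le_right _ _))
      tendsto_one_div_add_atTop_nhds_zero_nat
  have hd' : ∀ᵐ t ∂(volume.restrict (Ioc (0 : ℝ) 1)), ∀ᵐ x ∂ν,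
      DifferentiableWithinAt ℝ (fun u => W u x) (Icc (0 : ℝ) 1) t :=
    ae_mono (Measure.restrict_mono Ioc_subset_Icc_self le_rfl) hd
  have hF0 : ∀ a ∈ Icc (0 : ℝ) 1, F a a = 0 := by
    intro a ha
    have h1 := hF a ha a ha le_rfl (by simpa using hδ₀.le)
    have h2 := hW.meanSwap_le ha ha ha
    have h3 := meanSwap_nonneg (ν := ν) (W := W) (c := a) (a := a) (b := a)
    simp only [sub_self, abs_zero, zero_mul] at h2
    rw [le_antisymm h2 h3] at h1
    simpa using h1
  have hlim : Tendsto (fun k => ∫ t in Ioc (0 : ℝ) 1, (T k).step F t) atTop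
      (𝓝 (∫ t in Ioc (0 : ℝ) 1, instRejection ν W t)) := by
    refine tendsto_integral_of_dominated_convergence (fun _ => |C| + M)
      (fun k => (Schedule.measurable_step _ _).aestronglyMeasurable) (integrable_const _)
      (fun k => ?_) ?_
    · filter_upwards [ae_restrict_mem measurableSet_Ioc] with t ht
      exact hW.abs_step_le hF _ ((hT k).trans (min_le_left _ _)) ht
    · filter_upwards [hd', ae_restrict_mem measurableSet_Ioc] with t h1 h2
      exact hW.tendsto_step hδ₀ hF T hmesh h2 h1
  simp only [← intervalIntegral.integral_of_le zero_le_one, Schedule.integral_step _ _ hF0] at hlim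
  obtain ⟨k, hk⟩ := (Metric.tendsto_atTop.1 hlim ε hε)
  exact absurd (hlt k) (not_lt.2 (hk k le_rfl).le)

end LipschitzPath

end Annealing
end

/-! ### Annealing paths: Lipschitz increments and differentiability almost everywhere -/

noncomputable section

namespace Annealing

variable {X : Type*} [MeasurableSpace X]
variable {ν : Measure X} {V : X → ℝ≥0} {M : ℝ} {W : ℝ → X → ℝ} {a b c d t : ℝ}

lemma PiecewiseC2.exists_hasDerivAt {f : ℝ → ℝ} (hf : PiecewiseC2 f) :
    ∃ K : Finset ℝ, ∀ t ∈ Ioo (0 : ℝ) 1, t ∉ K →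
      HasDerivAt f (derivWithin f (Icc (0 : ℝ) 1) t) t := by
  obtain ⟨K, hK⟩ := hf
  refine ⟨K, fun t ht htK => ?_⟩
  have hI : Icc (0 : ℝ) 1 ∈ 𝓝 t := Icc_mem_nhds ht.1 ht.2
  have hmem : Icc (0 : ℝ) 1 \ K ∈ 𝓝 t :=
    inter_mem hI (K.finite_toSet.isClosed.isOpen_compl.mem_nhds (by simpa using htK))
  have h1 : DifferentiableAt ℝ f t := (hK.contDiffAt hmem).differentiableAt (by norm_num)
  rw [derivWithin_of_mem_nhds hI]
  exact h1.hasDerivAt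

/-- The mean value inequality on `[0, 1]`, with finitely many exceptional points. -/
lemma abs_sub_le_of_hasDerivAt_off_finset {f : ℝ → ℝ} {C : ℝ} {K : Finset ℝ}
    (hf : ContinuousOn f (Icc 0 1))
    (hd : ∀ t ∈ Ioo (0 : ℝ) 1, t ∉ K → DifferentiableAt ℝ f t ∧ |deriv f t| ≤ C)
    (ha : a ∈ Icc (0 : ℝ) 1) (hb : b ∈ Icc (0 : ℝ) 1) : |f b - f a| ≤ C * |b - a| := by
  wlog hab : a ≤ b generalizing a b
  · rw [abs_sub_comm, abs_sub_comm b a]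
    exact this hb ha (le_of_not_ge hab)
  have hbound : ∀ᵐ t, t ∈ Ioc a b → ‖deriv f t‖ ≤ C := by
    -- The endpoint `b` is excluded as well, since it may be `1`, where `hd` says nothing.
    filter_upwards [(K.finite_toSet.insert b).countable.ae_notMem volume] with t ht htab
    simp only [mem_insert_iff, Finset.mem_coe, not_or] at ht
    exact (hd t ⟨ha.1.trans_lt htab.1, (lt_of_le_of_ne htab.2 ht.1).trans_le hb.2⟩ ht.2).2
  have hi : IntervalIntegrable (deriv f) volume a b := by
    rw [intervalIntegrable_iff_integrableOn_Ioc_of_le hab]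
    refine (integrable_const C).mono' (measurable_deriv f).aestronglyMeasurable ?_
    rwa [ae_restrict_iff' measurableSet_Ioc]
  have hint := integral_eq_of_hasDerivAt_off_countable_of_le f (deriv f) hab
    K.finite_toSet.countable (hf.mono (Icc_subset_Icc ha.1 hb.2))
    (fun t ht => (hd t ⟨ha.1.trans_lt ht.1.1, ht.1.2.trans_le hb.2⟩ ht.2).1.hasDerivAt) hi
  rw [← hint, ← Real.norm_eq_abs]
  refine intervalIntegral.norm_integral_le_of_norm_le_const_ae ?_
  rwa [uIoc_of_le hab]

/-- A continuous function whose difference quotients converge along rational increments is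
differentiable. -/
lemma hasDerivAt_of_tendsto_slope_rat {f : ℝ → ℝ} (hf : Continuous f) {L : ℝ}
    (h : Tendsto (fun q : ℚ => (f (t + q) - f t) / (q : ℝ))
      (comap (fun q : ℚ => (q : ℝ)) (𝓝[≠] 0)) (𝓝 L)) : HasDerivAt f L t := by
  rw [hasDerivAt_iff_tendsto_slope_zero, Metric.tendsto_nhds]
  intro ε hε
  have h1 := h (Metric.closedBall_mem_nhds L (half_pos hε))
  obtain ⟨s, hs, hsub⟩ := mem_comap.1 (mem_map.1 h1)
  obtain ⟨U, hU, hU0, hUs⟩ := mem_nhdsWithin.1 hs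
  filter_upwards [inter_mem (mem_nhdsWithin_of_mem_nhds (hU.mem_nhds hU0)) self_mem_nhdsWithin]
    with u hu
  have hO : IsOpen (U ∩ {0}ᶜ) := hU.inter isOpen_compl_singleton
  have hcl : u ∈ closure ((U ∩ {0}ᶜ) ∩ range (fun q : ℚ => (q : ℝ))) :=
    Rat.denseRange_cast.open_subset_closure_inter hO hu
  have hu0 : u ≠ 0 := hu.2
  have hc : ContinuousAt (fun v : ℝ => v⁻¹ • (f (t + v) - f t)) u := by
    have : ContinuousAt (fun v : ℝ => v⁻¹) u := continuousAt_inv₀ hu0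
    fun_prop
  have hmaps : MapsTo (fun v : ℝ => v⁻¹ • (f (t + v) - f t))
      ((U ∩ {0}ᶜ) ∩ range (fun q : ℚ => (q : ℝ))) (Metric.closedBall L (ε / 2)) := by
    rintro _ ⟨hv, q, rfl⟩
    have := hsub (hUs hv : q ∈ (fun q : ℚ => (q : ℝ)) ⁻¹' s)
    simpa [div_eq_inv_mul] using this
  have h2 := hc.continuousWithinAt.mem_closure hcl hmaps
  rw [Metric.isClosed_closedBall.closure_eq] at h2
  exact (Metric.mem_closedBall.1 h2).trans_lt (half_lt_self hε)

namespace IsAnnealingPath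

lemma neZero (hpath : IsAnnealingPath ν W) : NeZero ν := by
  refine ⟨fun h => ?_⟩
  have := hpath.normalizer_pos 0 ⟨le_rfl, zero_le_one⟩
  simp [h] at this

/-- `ν` is absolutely continuous with respect to the probability measure `π_0`. This is what permits
Fubini for `ν`. -/
lemma sFinite (hpath : IsAnnealingPath ν W) : SFinite ν := by
  have := hpath.neZero
  have hi := hpath.integrable 0 ⟨le_rfl, zero_le_one⟩
  have := isProbabilityMeasure_tilted hi
  exact sFinite_of_absolutelyContinuous (absolutelyContinuous_tilted hi)

/-- The normalizers cancel in `log π_t(x) - log π_t(y)`. Jumps of `W` in time are therefore common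
to all points and disappear from differences. -/
lemma continuousOn_sub (hpath : IsAnnealingPath ν W) (x y : X) :
    ContinuousOn (fun t => W t x - W t y) (Icc (0 : ℝ) 1) := by
  have hpos : ∀ z, ∀ t ∈ Icc (0 : ℝ) 1, density ν W t z ≠ 0 := fun z t ht =>
    (div_pos (Real.exp_pos _) (hpath.normalizer_pos t ht)).ne'
  refine (((hpath.continuousOn x).log (hpos x)).sub
    ((hpath.continuousOn y).log (hpos y))).congr fun t ht => ?_
  have hZ := (hpath.normalizer_pos t ht).ne'
  simp only [density, Pi.sub_apply]
  rw [Real.log_div (Real.exp_pos _).ne' hZ, Real.log_div (Real.exp_pos _).ne' hZ, Real.log_exp,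
    Real.log_exp]
  ring

/-- The mean value inequality applies to `W t x - W t y`, which is continuous and differentiable off
the union of the two exceptional sets. -/
lemma incrementBound (hpath : IsAnnealingPath ν W) (hC2 : ∀ x, PiecewiseC2 (fun t => W t x))
    (hV : ∀ x, ∀ t ∈ Icc (0 : ℝ) 1, |dW W t x| ≤ V x)
    (ha : a ∈ Icc (0 : ℝ) 1) (hb : b ∈ Icc (0 : ℝ) 1) :
    IncrementBound V |b - a| (W a) (W b) := by
  intro x y
  obtain ⟨K, hK⟩ := (hC2 x).exists_hasDerivAt
  obtain ⟨K', hK'⟩ := (hC2 y).exists_hasDerivAt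
  have h := abs_sub_le_of_hasDerivAt_off_finset (K := K ∪ K') (C := V x + V y)
    (hpath.continuousOn_sub x y) (fun t ht htK => ?_) ha hb
  · rw [mul_comm]
    convert h using 2
    ring
  · rw [Finset.mem_union, not_or] at htK
    have hd := (hK t ht htK.1).sub (hK' t ht htK.2)
    refine ⟨hd.differentiableAt, ?_⟩
    have htI : t ∈ Icc (0 : ℝ) 1 := ⟨ht.1.le, ht.2.le⟩
    have e : deriv (fun t => W t x - W t y) t = dW W t x - dW W t y := hd.deriv
    rw [e]
    exact (abs_sub _ _).trans (add_le_add (hV x t htI) (hV y t htI))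

lemma exists_lipschitzPath (hpath : IsAnnealingPath ν W)
    (hC2 : ∀ x, PiecewiseC2 (fun t => W t x)) (hVm : Measurable V)
    (hV : ∀ x, ∀ t ∈ Icc (0 : ℝ) 1, |dW W t x| ≤ V x)
    (hVint : supMean ν W (fun x => (V x : ℝ≥0∞) ^ 3) < ∞) :
    ∃ M, LipschitzPath ν V M W := by
  have := hpath.neZero
  set S := supMean ν W (fun x => (V x : ℝ≥0∞) ^ 3) with hS
  refine ⟨1 + S.toReal, hVm, by linarith [S.toReal_nonneg], fun t ht => ?_,
    fun a ha b hb => hpath.incrementBound hC2 hV ha hb⟩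
  have hi := hpath.integrable t ht
  have hP : IsProbabilityMeasure (ν.tilted (W t)) := isProbabilityMeasure_tilted hi
  have hle : ∫⁻ x, (V x : ℝ≥0∞) ^ 3 ∂(ν.tilted (W t)) ≤ S :=
    le_iSup₂ (f := fun t (_ : t ∈ Icc (0 : ℝ) 1) => ∫⁻ x, (V x : ℝ≥0∞) ^ 3 ∂(law ν W t)) t ht
  have hlint : ∫⁻ x, ENNReal.ofReal ((V x : ℝ) ^ 3) ∂(ν.tilted (W t))
      = ∫⁻ x, (V x : ℝ≥0∞) ^ 3 ∂(ν.tilted (W t)) := by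
    refine lintegral_congr fun x => ?_
    rw [ENNReal.ofReal_pow (V x).coe_nonneg, ENNReal.ofReal_coe_nnreal]
  have hcm : Measurable fun x => (V x : ℝ) ^ 3 := by fun_prop
  have hc0 : ∀ x, 0 ≤ (V x : ℝ) ^ 3 := fun x => pow_nonneg (V x).2 3
  have hcube : Integrable (fun x => (V x : ℝ) ^ 3) (ν.tilted (W t)) := by
    refine ⟨hcm.aestronglyMeasurable, ?_⟩
    rw [hasFiniteIntegral_iff_ofReal (Eventually.of_forall hc0), hlint]
    exact hle.trans_lt hVint
  have hcubele : ∫ x, (V x : ℝ) ^ 3 ∂(ν.tilted (W t)) ≤ S.toReal := by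
    rw [integral_eq_lintegral_of_nonneg_ae (Eventually.of_forall hc0) hcm.aestronglyMeasurable,
      hlint]
    exact ENNReal.toReal_mono hVint.ne hle
  have hdom : Integrable (fun x => 1 + (V x : ℝ) ^ 3) (ν.tilted (W t)) :=
    (integrable_const 1).add hcube
  have hdomle : ∫ x, (1 + (V x : ℝ) ^ 3) ∂(ν.tilted (W t)) ≤ 1 + S.toReal := by
    rw [integral_add (integrable_const 1) hcube]
    simpa using hcubele
  have key : ∀ φ : X → ℝ, Measurable φ → (∀ x, 0 ≤ φ x) → (∀ x, φ x ≤ 1 + (V x : ℝ) ^ 3) →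
      Integrable φ (ν.tilted (W t)) ∧ ∫ x, φ x ∂(ν.tilted (W t)) ≤ 1 + S.toReal := by
    intro φ hφ h0 h1
    have : Integrable φ (ν.tilted (W t)) :=
      hdom.mono' hφ.aestronglyMeasurable (Eventually.of_forall fun x => by
        rw [Real.norm_of_nonneg (h0 x)]; exact h1 x)
    exact ⟨this, (integral_mono this hdom h1).trans hdomle⟩
  -- For `v ≥ 0`, both `v` and `v²` are at most `1 + v³`.
  have k1 := key (fun x => (V x : ℝ)) (by fun_prop) (fun x => (V x).2) (fun x => by
    have := (V x).coe_nonneg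
    nlinarith [mul_nonneg this (sq_nonneg ((V x : ℝ) - 1)), sq_nonneg ((V x : ℝ) - 1)])
  have k2 := key (fun x => (V x : ℝ) ^ 2) (by fun_prop) (fun x => sq_nonneg _) (fun x => by
    have := (V x).coe_nonneg
    nlinarith [mul_nonneg this (sq_nonneg ((V x : ℝ) - 1)), sq_nonneg ((V x : ℝ) - 1)])
  exact ⟨hpath.measurable t ht, hi, k2.1, k1.2, k2.2⟩

/-- For almost every time, almost every log-density is differentiable at that time. -/
lemma ae_ae_differentiableWithinAt (hpath : IsAnnealingPath ν W)
    (hC2 : ∀ x, PiecewiseC2 (fun t => W t x)) :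
    ∀ᵐ t ∂(volume.restrict (Icc (0 : ℝ) 1)), ∀ᵐ x ∂ν,
      DifferentiableWithinAt ℝ (fun u => W u x) (Icc (0 : ℝ) 1) t := by
  have := hpath.neZero
  have := hpath.sFinite
  obtain ⟨x₀⟩ : Nonempty X := by
    by_contra h
    rw [not_nonempty_iff] at h
    exact NeZero.ne ν (Measure.eq_zero_of_isEmpty ν)
  -- Subtracting a reference point `x₀` removes the common jumps, and clamping time to `[0, 1]`
  -- makes `D` continuous in `t` on the whole line, hence jointly measurable.
  set D : ℝ → X → ℝ := fun t x =>
    W (projIcc 0 1 zero_le_one t) x - W (projIcc 0 1 zero_le_one t) x₀ with hD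
  have hDc : ∀ x, Continuous fun t => D t x := fun x =>
    (continuousOn_iff_continuous_domRestrict.1 (hpath.continuousOn_sub x x₀)).comp continuous_projIcc
  have hDm : ∀ t, Measurable (D t) := fun t =>
    (hpath.measurable _ (projIcc 0 1 zero_le_one t).2).sub_const _
  have hDj : Measurable (Function.uncurry D) := measurable_uncurry_of_continuous_of_measurable hDc hDm
  have hDeq : ∀ x, ∀ t ∈ Ioo (0 : ℝ) 1, (fun u => D u x) =ᶠ[𝓝 t] fun u => W u x - W u x₀ := by
    intro x t ht
    filter_upwards [Icc_mem_nhds ht.1 ht.2] with u hu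
    simp only [hD, projIcc_of_mem zero_le_one hu]
  obtain ⟨K₀, hK₀⟩ := (hC2 x₀).exists_hasDerivAt
  have hIoo : ∀ K : Finset ℝ, ∀ᵐ t ∂(volume.restrict (Icc (0 : ℝ) 1)),
      t ∈ Ioo (0 : ℝ) 1 ∧ t ∉ K := by
    intro K
    rw [← restrict_Ioo_eq_restrict_Icc]
    filter_upwards [ae_restrict_mem measurableSet_Ioo,
      K.finite_toSet.countable.ae_notMem (volume.restrict (Ioo (0 : ℝ) 1))] with t h1 h2
    exact ⟨h1, by simpa using h2⟩
  -- Restricting to rational increments makes the differentiability set measurable by countability,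
  -- so the quantifiers over `t` and `x` may be exchanged; continuity of `D` later recovers the full
  -- derivative.
  set p : ℝ → X → Prop := fun t x => ∃ L, Tendsto
    (fun q : ℚ => (D (t + q) x - D t x) / (q : ℝ))
      (comap (fun q : ℚ => (q : ℝ)) (𝓝[≠] 0)) (𝓝 L) with hp
  have hpm : MeasurableSet {z : ℝ × X | p z.1 z.2} := by
    refine measurableSet_exists_tendsto fun q => ?_
    have h1 : Measurable fun z : ℝ × X => D (z.1 + q) z.2 :=
      hDj.comp ((measurable_fst.add_const _).prodMk measurable_snd)
    exact (h1.sub hDj).div_const _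
  have hx : ∀ᵐ x ∂ν, ∀ᵐ t ∂(volume.restrict (Icc (0 : ℝ) 1)), p t x := by
    refine Eventually.of_forall fun x => ?_
    obtain ⟨K, hK⟩ := (hC2 x).exists_hasDerivAt
    filter_upwards [hIoo K₀, hIoo K] with t h1 h2
    have hd := ((hK t h2.1 h2.2).sub (hK₀ t h1.1 h1.2)).congr_of_eventuallyEq (hDeq x t h1.1)
    refine ⟨_, ((hasDerivAt_iff_tendsto_slope_zero.1 hd).comp tendsto_comap).congr fun q => ?_⟩
    simp [div_eq_inv_mul]
  filter_upwards [(Measure.ae_ae_comm hpm).2 hx, hIoo K₀] with t h1 h2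
  filter_upwards [h1] with x hx
  obtain ⟨L, hL⟩ := hx
  have hd := (hasDerivAt_of_tendsto_slope_rat (hDc x) hL).congr_of_eventuallyEq
    (hDeq x t h2.1).symm
  have hd' := (hd.add (hK₀ t h2.1 h2.2)).differentiableAt
  refine DifferentiableAt.differentiableWithinAt (hd'.congr_of_eventuallyEq ?_)
  exact Eventually.of_forall fun u => by simp

end IsAnnealingPath

end Annealing
end

/-! ### The round trip rate and the theorem -/

section

namespace Annealing

variable {X : Type*} [MeasurableSpace X]
variable {ν : Measure X} {V : X → ℝ≥0} {M : ℝ} {W : ℝ → X → ℝ} {a b c d t : ℝ}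

lemma tendsto_iSup_mesh {f : ∀ N : ℕ, Schedule N → ℝ}
    (h : ∀ ε > 0, ∃ δ > 0, ∀ (N : ℕ) (T : Schedule N), T.mesh ≤ δ → |f N T| ≤ ε) :
    Tendsto (fun δ : ℝ => ⨆ (N : ℕ) (T : Schedule N) (_ : T.mesh ≤ δ), ENNReal.ofReal |f N T|)
      (𝓝[>] 0) (𝓝 0) := by
  rw [ENNReal.tendsto_nhds_zero]
  intro ε hε
  obtain ⟨ε', -, h0, hε'⟩ := ENNReal.lt_iff_exists_real_btwn.1 hε
  obtain ⟨δ₁, hδ₁, hf⟩ := h ε' (ENNReal.ofReal_pos.1 h0)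
  filter_upwards [mem_nhdsWithin_of_mem_nhds (Iio_mem_nhds hδ₁)] with δ hδ
  refine iSup_le fun N => iSup_le fun T => iSup_le fun hT => ?_
  exact (ENNReal.ofReal_le_ofReal (hf N T (hT.trans (le_of_lt hδ)))).trans hε'.le

lemma abs_inv_sub_inv_le {u v : ℝ} (hu : 0 ≤ u) (hv : 0 ≤ v) :
    |(2 + 2 * u)⁻¹ - (2 + 2 * v)⁻¹| ≤ |u - v| := by
  have hu' : 0 < 2 + 2 * u := by linarith
  have hv' : 0 < 2 + 2 * v := by linarith
  rw [inv_sub_inv hu'.ne' hv'.ne', abs_div, abs_of_pos (mul_pos hu' hv'),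
    div_le_iff₀ (mul_pos hu' hv'), show 2 + 2 * v - (2 + 2 * u) = -(2 * (u - v)) by ring, abs_neg,
    abs_mul, abs_two]
  nlinarith [abs_nonneg (u - v), mul_nonneg hu hv, mul_nonneg (abs_nonneg (u - v)) hu,
    mul_nonneg (abs_nonneg (u - v)) hv, mul_nonneg (abs_nonneg (u - v)) (mul_nonneg hu hv)]

lemma scheduleBarrier_nonneg {N : ℕ} (T : Schedule N) : 0 ≤ scheduleBarrier ν W T :=
  Finset.sum_nonneg fun _ _ => mul_nonneg (by norm_num)
    (intervalIntegral.integral_nonneg zero_le_one fun _ _ => integral_nonneg fun _ => abs_nonneg _)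

namespace LipschitzPath

variable [NeZero ν]

/-- The acceptance probability is the mean of a strictly positive function bounded by one, so the
odds `r / (1 - r)` have a nonzero denominator and are nonnegative. -/
lemma rejection_mem_Ico (hW : LipschitzPath ν V M W) (ha : a ∈ Icc (0 : ℝ) 1)
    (hb : b ∈ Icc (0 : ℝ) 1) : rejection ν W a b ∈ Ico (0 : ℝ) 1 := by
  have := hW.isProbabilityMeasure_law ha
  have := hW.isProbabilityMeasure_law hb
  have hm := hW.measurable_swapExponent ha hb
  have hle : ∀ p : X × X, Real.exp (min 0 (swapExponent W a b p.1 p.2)) ≤ 1 := fun p =>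
    Real.exp_le_one_iff.2 (min_le_left _ _)
  have hi : Integrable (fun p : X × X => Real.exp (min 0 (swapExponent W a b p.1 p.2)))
      ((law ν W a).prod (law ν W b)) := by
    refine (integrable_const (1 : ℝ)).mono' (by fun_prop) (Eventually.of_forall fun p => ?_)
    rw [Real.norm_of_nonneg (Real.exp_pos _).le]
    exact hle p
  have h1 := integral_mono hi (integrable_const 1) hle
  have h2 := integral_exp_pos hi
  simp only [integral_const, probReal_univ, smul_eq_mul, mul_one] at h1
  unfold rejection
  constructor <;> linarith

lemma abs_rejection_odds_sub_meanSwap_le (hW : LipschitzPath ν V M W) (ha : a ∈ Icc (0 : ℝ) 1)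
    (hb : b ∈ Icc (0 : ℝ) 1) (hab : a ≤ b) (hδ : b - a ≤ 1 / (26 * M ^ 2)) :
    |rejection ν W a b / (1 - rejection ν W a b) - meanSwap ν W a a b|
      ≤ (338 * M ^ 4 + 12 * M ^ 2) * (b - a) ^ 2 := by
  have hM := hW.one_le
  have hr := hW.rejection_mem_Ico ha hb
  have h1 := hW.abs_rejection_sub_meanSwap_le ha hb
  have h2 := hW.meanSwap_le ha ha hb
  have h0 : 0 ≤ b - a := sub_nonneg.2 hab
  rw [abs_of_nonneg h0] at h2
  set r := rejection ν W a b
  set m := meanSwap ν W a a b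
  have hM2 : M ≤ M ^ 2 := by nlinarith
  have hle1 : b - a ≤ 1 := by linarith [hb.2, ha.1]
  -- `13 = 12 + 1`, from the second-order error and `meanSwap`. The assumption `hδ` then forces `r ≤
  -- 1 / 2`, so passing from `r` to the odds costs at most `2 * r²`, and `338 = 2 * 13²`.
  have h3 : r ≤ 13 * M ^ 2 * (b - a) := by
    have h4 := (abs_le.1 h1).2
    have h5 : 12 * M ^ 2 * (b - a) ^ 2 ≤ 12 * M ^ 2 * (b - a) :=
      mul_le_mul_of_nonneg_left (by nlinarith) (by positivity)
    have h6 := mul_le_mul_of_nonneg_left hM2 h0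
    linarith
  have h4 : r ≤ 1 / 2 := by
    rw [le_div_iff₀ (by positivity)] at hδ
    linarith
  have h5 : |r / (1 - r) - r| ≤ 2 * r ^ 2 := by
    have h6 : 0 < 1 - r := by linarith
    have e : r / (1 - r) - r = r ^ 2 / (1 - r) := by field_simp; ring
    rw [e, abs_of_nonneg (div_nonneg (sq_nonneg r) h6.le), div_le_iff₀ h6]
    nlinarith [sq_nonneg r]
  have h6 : r ^ 2 ≤ (13 * M ^ 2 * (b - a)) ^ 2 := pow_le_pow_left₀ hr.1 h3 2
  have h7 := abs_sub_le (r / (1 - r)) r m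
  nlinarith

end LipschitzPath

end Annealing

end

theorem theorem1 {X : Type*} [MeasurableSpace X] (ν : Measure X) (W : ℝ → X → ℝ)
    (hpath : Annealing.IsAnnealingPath ν W)
    (hC2 : ∀ x, Annealing.PiecewiseC2 (fun t => W t x))
    (V₁ V₂ : X → ℝ≥0) (hV₁m : Measurable V₁) (hV₂m : Measurable V₂)
    (hV₁ : ∀ x, ∀ t ∈ Icc (0 : ℝ) 1, |Annealing.dW W t x| ≤ V₁ x)
    (hV₁int : Annealing.supMean ν W (fun x => (V₁ x : ℝ≥0∞) ^ 3) < ∞)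
    (hV₂ : ∀ x, ∀ t ∈ Icc (0 : ℝ) 1, |Annealing.d2W W t x| ≤ V₂ x)
    (ε : ℝ) (hε : 0 < ε)
    (hV₂int : Annealing.supMean ν W
      (fun x => ENNReal.ofReal ((1 + V₁ x) * Real.exp (ε * V₂ x))) < ∞) :
    -- the round trip rate is asymptotically `(2 + 2 Λ(T_N))⁻¹`, uniformly over schedules
    Tendsto (fun δ : ℝ => ⨆ (N : ℕ) (T : Annealing.Schedule N) (_ : T.mesh ≤ δ),
        ENNReal.ofReal |(2 + 2 * Annealing.scheduleBarrier ν W T)⁻¹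
          - Annealing.roundTripRate ν W T|) (𝓝[>] 0) (𝓝 0) ∧
    -- `Λ(T_N)` converges to `Λ`, uniformly over schedules
    Tendsto (fun δ : ℝ => ⨆ (N : ℕ) (T : Annealing.Schedule N) (_ : T.mesh ≤ δ),
        ENNReal.ofReal |Annealing.scheduleBarrier ν W T - Annealing.globalBarrier ν W|)
      (𝓝[>] 0) (𝓝 0) ∧
    -- `λ` is integrable, so that `Λ = ∫₀¹ λ(t) dt` is meaningful
    IntervalIntegrable (Annealing.instRejection ν W) volume 0 1 ∧
    -- for almost every `t`, `W` is differentiable at `t` for almost every `x`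
    (∀ᵐ t ∂(volume.restrict (Icc (0 : ℝ) 1)), ∀ᵐ x ∂ν,
      DifferentiableWithinAt ℝ (fun u => W u x) (Icc (0 : ℝ) 1) t) ∧
    -- at every such `t`, `λ(t)` is finite and is the limit of `r(t + Δt, t) / |Δt|` as `Δt → 0`
    (∀ t ∈ Icc (0 : ℝ) 1,
      (∀ᵐ x ∂ν, DifferentiableWithinAt ℝ (fun u => W u x) (Icc (0 : ℝ) 1) t) →
      Integrable (fun p : X × X => |Annealing.dW W t p.1 - Annealing.dW W t p.2|)
          ((Annealing.law ν W t).prod (Annealing.law ν W t)) ∧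
        Tendsto (fun h : ℝ => Annealing.rejection ν W (t + h) t / |h|)
          (𝓝[{h : ℝ | h ≠ 0 ∧ t + h ∈ Icc (0 : ℝ) 1}] 0)
          (𝓝 (Annealing.instRejection ν W t))) := by
  have := hpath.neZero
  obtain ⟨M, hW⟩ := hpath.exists_lipschitzPath hC2 hV₁m hV₁ hV₁int
  have hd := hpath.ae_ae_differentiableWithinAt hC2
  have hM : 0 < M := one_pos.trans_le hW.one_le
  have hbarrier : ∀ ε > 0, ∃ δ > 0, ∀ (N : ℕ) (T : Annealing.Schedule N), T.mesh ≤ δ →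
      |Annealing.scheduleBarrier ν W T - Annealing.globalBarrier ν W| ≤ ε := by
    intro ε hε
    -- The threshold `1 / (8 * M)` is the smallness needed to control the normalizers along secants.
    refine hW.exists_mesh_abs_sum_sub_le (F := Annealing.secantBarrier ν W)
      (δ₀ := 1 / (8 * M)) (C := 128 * M ^ 2) hd (by positivity) (fun a ha b hb hab hδ => ?_) hε
    refine hW.abs_secantBarrier_sub_meanSwap_le ha hb ?_
    rw [abs_of_nonneg (sub_nonneg.2 hab)]
    rwa [le_div_iff₀ (by positivity), mul_comm] at hδ
  refine ⟨Annealing.tendsto_iSup_mesh fun ε hε => ?_, Annealing.tendsto_iSup_mesh hbarrier,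
    hW.intervalIntegrable_instRejection hd, hd, fun t ht hdt =>
      ⟨(hW.tendsto_meanSwap_div ht hdt).1, hW.tendsto_rejection_div ht hdt⟩⟩
  -- The secant sum and the sum of odds are each compared with the common limit `Λ`.
  obtain ⟨δ₁, hδ₁, h1⟩ := hbarrier (ε / 2) (half_pos hε)
  obtain ⟨δ₂, hδ₂, h2⟩ := hW.exists_mesh_abs_sum_sub_le
    (F := fun a b => Annealing.rejection ν W a b / (1 - Annealing.rejection ν W a b)) hd
    (δ₀ := 1 / (26 * M ^ 2)) (by positivity)
    (fun a ha b hb hab hδ => hW.abs_rejection_odds_sub_meanSwap_le ha hb hab hδ) (half_pos hε)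
  refine ⟨min δ₁ δ₂, lt_min hδ₁ hδ₂, fun N T hT => ?_⟩
  have h3 := h1 N T (hT.trans (min_le_left _ _))
  have h4 := h2 N T (hT.trans (min_le_right _ _))
  rw [abs_sub_comm] at h4
  refine (Annealing.abs_inv_sub_inv_le (Annealing.scheduleBarrier_nonneg T)
    (Finset.sum_nonneg fun n _ => ?_)).trans ?_
  · have hr := hW.rejection_mem_Ico (T.pt_mem_Icc n.castSucc) (T.pt_mem_Icc n.succ)
    exact div_nonneg hr.1 (sub_nonneg.2 hr.2.le)
  · exact (abs_sub_le _ (Annealing.globalBarrier ν W) _).trans (by linarith)
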